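/- **Setting.** A *flow graph* $G$ is a finite directed acyclic multigraph with vertices $0<1<\dots<n$ ($n\ge 0$), every edge directed from a smaller to a larger vertex, whose only source is $s=0$ and whose only sink is $t=n$. A *framing* $F$ consists of a linear order on the incoming edges and a linear order on the outgoing edges of each vertex. *Paths* are directed, and paths of length $0$ are allowed; a *route* is a path from $s$ to $t$. If $v$ is a vertex of a path $P$, then $Pv$ and $vP$ denote the parts of $P$ ending and beginning at $v$. For paths $A,B$ ending at $v$, remove their longest common final part. If both still have an edge, the last remaining edges enter the same vertex; write $A<_{\mathcal I(v)}B$ if that of $A$ precedes that of $B$ in the framing. For paths $A,B$ beginning at $v$, define $A<_{\mathcal O(v)}B$ symmetrically, removing the longest common initial part and comparing the first remaining edges. These relations are strict linear orders on the paths from $s$ to $v$, respectively from $v$ to $t$. For paths $P,Q$ through $v$, write $P<^{\mathrm{cw}}_vQ$ ($P$ is *clockwise* from $Q$ at $v$) if $Pv<_{\mathcal I(v)}Qv$ and $vQ<_{\mathcal O(v)}vP$. Paths $P,Q$ are *coherent* if neither $P<^{\mathrm{cw}}_vQ$ nor $Q<^{\mathrm{cw}}_vP$ holds at any vertex $v$.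 A *clique* is a set of pairwise coherent routes. For maximal cliques $C\ne C'$, the clique $C'$ is obtained from $C$ by a *ccw rotation* if $C'=(C\setminus\{R\})\cup\{R'\}$ with $R\in C$ and $R<^{\mathrm{cw}}_vR'$ for some $v$. The *framing poset* $\mathscr L_{G,F}$ is the set of maximal cliques ordered by the reflexive transitive closure of ccw rotation. For a path $P$ (with arbitrary endpoints) let $\mathrm{ccw}(P)$, respectively $\mathrm{cw}(P)$, be the set of routes $R$ with $P<^{\mathrm{cw}}_vR$, respectively $R<^{\mathrm{cw}}_vP$, for some $v$. For maximal cliques $C,C'$ let $$\mathrm{Rem}_{\mathrm{ccw}}(C,C')=\bigcup_{\substack{P\text{ a path}\\ \mathrm{ccw}(P)\cap(C\cup C')=\emptyset}}\mathrm{ccw}(P),\qquad \mathrm{Rem}_{\mathrm{cw}}(C,C')=\bigcup_{\substack{P\text{ a path}\\ \mathrm{cw}(P)\cap(C\cup C')=\emptyset}}\mathrm{cw}(P).$$ Let $C_{\max}^{\mathrm{Rem}}(C,C')$ be the set of routes computed as follows. Start with $X:=C\cap C'$. For each vertex $v$ in increasing order, and for each path $A$ from $s$ to $v$ in decreasing order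 for $<_{\mathcal I(v)}$, run through the paths $B$ from $v$ to $t$ in increasing order for $<_{\mathcal O(v)}$; at the first $B$, if any, for which the concatenated route $AB$ is coherent with every route in the current $X$ and does not lie in $\mathrm{Rem}_{\mathrm{ccw}}(C,C')$, add $AB$ to $X$ and pass to the next $A$. The result is the final $X$. Let $C_{\min}^{\mathrm{Rem}}(C,C')$ be computed in the same way, but with the paths $A$ in increasing order for $<_{\mathcal I(v)}$, the paths $B$ in decreasing order for $<_{\mathcal O(v)}$, and $\mathrm{Rem}_{\mathrm{cw}}(C,C')$ in place of $\mathrm{Rem}_{\mathrm{ccw}}(C,C')$. **Theorem.** Let $(G,F)$ be a framed flow graph. The framing poset $\mathscr L_{G,F}$ is a lattice, and for all maximal cliques $C,C'$ of $(G,F)$ the sets $C_{\max}^{\mathrm{Rem}}(C,C')$ and $C_{\min}^{\mathrm{Rem}}(C,C')$ are maximal cliques and are respectively the join and the meet of $C$ and $C'$ in it: $$C\vee C'=C_{\max}^{\mathrm{Rem}}(C,C'),\qquad C\wedge C'=C_{\min}^{\mathrm{Rem}}(C,C').$$ -/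

import Mathlib

/-- A flow graph on the vertices `0 < 1 < ⋯ < n` with edge set `E` (parallel edges are allowed):
every edge is directed from a smaller vertex to a larger one, `0` is the only source and `n` is the
only sink. -/
structure FlowGraph (n : ℕ) (E : Type*) where
  /-- the initial vertex of an edge -/
  src : E → Fin (n + 1)
  /-- the terminal vertex of an edge -/
  tgt : E → Fin (n + 1)
  src_lt_tgt : ∀ e, src e < tgt e
  exists_in : ∀ v, v ≠ 0 → ∃ e, tgt e = v
  exists_out : ∀ v, v ≠ Fin.last n → ∃ e, src e = v

namespace FlowGraph

variable {n : ℕ} {E : Type*} (G : FlowGraph n E)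

/-- The list `l` of edges is the sequence of edges of a directed path from `u` to `v`. -/
def IsWalk : Fin (n + 1) → List E → Fin (n + 1) → Prop
  | u, [], v => u = v
  | u, e :: l, v => G.src e = u ∧ IsWalk (G.tgt e) l v

/-- Directed paths from `u` to `v`, given by their sequences of edges. The path of length `0`
from `u` to `u` is included. -/
def Path (u v : Fin (n + 1)) : Type _ := {l : List E // G.IsWalk u l v}

/-- A route is a path from the source to the sink. -/
abbrev Route : Type _ := G.Path 0 (Fin.last n)

variable {G}

theorem IsWalk.append {u v w : Fin (n + 1)} {l m : List E} (hl : G.IsWalk u l v)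
    (hm : G.IsWalk v m w) : G.IsWalk u (l ++ m) w := by
  induction l generalizing u with
  | nil => cases hl; exact hm
  | cons e l ih => exact ⟨hl.1, ih hl.2⟩

theorem IsWalk.lt_tgt {u v : Fin (n + 1)} {l : List E} (hl : G.IsWalk u l v) :
    ∀ e ∈ l, u < G.tgt e := by
  induction l generalizing u with
  | nil => simp
  | cons e l ih =>
    intro f hf
    have h : u < G.tgt e := hl.1 ▸ G.src_lt_tgt e
    rcases List.mem_cons.1 hf with rfl | hf
    · exact h
    · exact h.trans (ih hl.2 f hf)

theorem IsWalk.nodup {u v : Fin (n + 1)} {l : List E} (hl : G.IsWalk u l v) : l.Nodup := by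
  induction l generalizing u with
  | nil => exact List.nodup_nil
  | cons e l ih =>
    exact List.nodup_cons.2 ⟨fun h => lt_irrefl _ (hl.2.lt_tgt e h), ih hl.2⟩

/-- There are only finitely many paths between two vertices of a finite flow graph. -/
instance [Finite E] (u v : Fin (n + 1)) : Finite (G.Path u v) := by
  classical
  have := Fintype.ofFinite E
  exact Finite.of_injective
    (fun p : G.Path u v => (⟨p.1, IsWalk.nodup p.2⟩ : {l : List E // l.Nodup}))
    (fun _ _ h => Subtype.ext (Subtype.mk.inj h))

/-- Concatenation of paths. For `P` ending at `v` and `Q` beginning at `v`, this is `PvQ`. -/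
def Path.append {u v w : Fin (n + 1)} (P : G.Path u v) (Q : G.Path v w) : G.Path u w :=
  ⟨P.1 ++ Q.1, IsWalk.append P.2 Q.2⟩

variable (G)

/-- A framing: at every vertex, a linear order on the incoming edges and a linear order on the
outgoing edges. -/
structure Framing where
  inOrder : ∀ v, LinearOrder {e : E // G.tgt e = v}
  outOrder : ∀ v, LinearOrder {e : E // G.src e = v}

variable {G}

namespace Framing

variable (F : G.Framing)

/-- `e` and `f` enter the same vertex, and `e` comes before `f` in its framing. -/
def InEdgeLT (e f : E) : Prop :=
  ∃ h : G.tgt e = G.tgt f, (F.inOrder (G.tgt f)).lt ⟨e, h⟩ ⟨f, rfl⟩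

/-- `e` and `f` leave the same vertex, and `e` comes before `f` in its framing. -/
def OutEdgeLT (e f : E) : Prop :=
  ∃ h : G.src e = G.src f, (F.outOrder (G.src f)).lt ⟨e, h⟩ ⟨f, rfl⟩

/-- The strict relation `P < Q` between two paths ending at `v`: before their longest common final
part `c`, both paths have an edge, and the last such edge `e` of `P` comes before the last such
edge `f` of `Q`. -/
def InLT {a b v : Fin (n + 1)} (P : G.Path a v) (Q : G.Path b v) : Prop :=
  ∃ (p q c : List E) (e f : E), P.1 = p ++ e :: c ∧ Q.1 = q ++ f :: c ∧ F.InEdgeLT e f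

/-- The strict relation `P < Q` between two paths beginning at `v`: after their longest common
initial part `c`, both paths have an edge, and the first such edge `e` of `P` comes before the
first such edge `f` of `Q`. -/
def OutLT {v a b : Fin (n + 1)} (P : G.Path v a) (Q : G.Path v b) : Prop :=
  ∃ (c p q : List E) (e f : E), P.1 = c ++ e :: p ∧ Q.1 = c ++ f :: q ∧ F.OutEdgeLT e f

/-- `P ≤ Q` for paths ending at `v`. Any two paths ending at `v` satisfy exactly one of `P < Q`,
`P = Q` (in the sense that one is a final part of the other) and `Q < P`, so `P ≤ Q` says that
`Q < P` fails. On the paths from the source to `v` this is a linear order. -/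
def InLE {a b v : Fin (n + 1)} (P : G.Path a v) (Q : G.Path b v) : Prop := ¬ F.InLT Q P

/-- `P ≤ Q` for paths beginning at `v`; on the paths from `v` to the sink it is a linear order. -/
def OutLE {v a b : Fin (n + 1)} (P : G.Path v a) (Q : G.Path v b) : Prop := ¬ F.OutLT Q P

/-- `P` is clockwise from `Q` at `v`: both paths pass through `v`, and `Pv < Qv` and `vQ < vP`.
(The strict inequalities force `v` to be an inner vertex of both paths.) -/
def CW {a b c d : Fin (n + 1)} (v : Fin (n + 1)) (P : G.Path a b) (Q : G.Path c d) : Prop :=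
  ∃ (Pv : G.Path a v) (vP : G.Path v b) (Qv : G.Path c v) (vQ : G.Path v d),
    P = Pv.append vP ∧ Q = Qv.append vQ ∧ F.InLT Pv Qv ∧ F.OutLT vQ vP

/-- Two paths are coherent if at every vertex neither is clockwise from the other. -/
def Coherent {a b c d : Fin (n + 1)} (P : G.Path a b) (Q : G.Path c d) : Prop :=
  ∀ v, ¬ F.CW v P Q ∧ ¬ F.CW v Q P

/-- A clique is a set of pairwise coherent routes. -/
def IsClique (C : Set G.Route) : Prop := ∀ P ∈ C, ∀ Q ∈ C, F.Coherent P Q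

/-- The maximal cliques of a framed graph: the elements of the framing poset. -/
def MaxClique : Type _ := {C : Set G.Route // Maximal F.IsClique C}

variable {F}

/-- `D` is obtained from `C` by a counterclockwise rotation: `D = (C ∖ {R}) ∪ {R'}` where `R` is
clockwise from `R'` at some vertex. -/
def CCWRotation (C D : F.MaxClique) : Prop :=
  C ≠ D ∧ ∃ R ∈ C.1, ∃ R' : G.Route, D.1 = (C.1 \ {R}) ∪ {R'} ∧ ∃ v, F.CW v R R'

/-- The order of the framing poset: the reflexive transitive closure of counterclockwise
rotation. -/
def RotLE : F.MaxClique → F.MaxClique → Prop := Relation.ReflTransGen CCWRotation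

variable (F)

/-- The set of routes counterclockwise from `P`. -/
def ccw {a b : Fin (n + 1)} (P : G.Path a b) : Set G.Route := {R | ∃ v, F.CW v P R}

/-- The set of routes clockwise from `P`. -/
def cw {a b : Fin (n + 1)} (P : G.Path a b) : Set G.Route := {R | ∃ v, F.CW v R P}

/-- The union of all sets `ccw P` that are disjoint from `C ∪ C'`, over all paths `P`. -/
def RemCCW (C C' : Set G.Route) : Set G.Route :=
  {R | ∃ (a b : Fin (n + 1)) (P : G.Path a b), F.ccw P ∩ (C ∪ C') = ∅ ∧ R ∈ F.ccw P}

/-- The union of all sets `cw P` that are disjoint from `C ∪ C'`, over all paths `P`. -/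
def RemCW (C C' : Set G.Route) : Set G.Route :=
  {R | ∃ (a b : Fin (n + 1)) (P : G.Path a b), F.cw P ∩ (C ∪ C') = ∅ ∧ R ∈ F.cw P}

section Algorithm

open scoped Classical in
/-- The innermost loop: run through a list of routes, and add to `S` the first one that is coherent
with all routes in `S` and does not lie in `Rem`; if there is none, `S` is returned. -/
noncomputable def addFirst (Rem S : Set G.Route) : List G.Route → Set G.Route
  | [] => S
  | R :: L => if (∀ Q ∈ S, F.Coherent R Q) ∧ R ∉ Rem then S ∪ {R} else addFirst Rem S L

/-- The three nested loops, starting from `S`: for `v` in increasing order, for `Pv` in the list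
`ins v` of paths from the source to `v`, for `vQ` in the list `outs v` of paths from `v` to the
sink, try to add `PvQ`, and leave the innermost loop after the first success. -/
noncomputable def greedy (ins : ∀ v, List (G.Path 0 v)) (outs : ∀ v, List (G.Path v (Fin.last n)))
    (Rem S : Set G.Route) : Set G.Route :=
  (List.finRange (n + 1)).foldl
    (fun T v => (ins v).foldl (fun T P => F.addFirst Rem T ((outs v).map fun Q => P.append Q)) T) S

variable [Finite E]

/-- A list of all paths from `u` to `v`, without repetitions. -/
noncomputable def pathList (G : FlowGraph n E) (u v : Fin (n + 1)) : List (G.Path u v) :=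
  (Set.finite_univ (α := G.Path u v)).toFinset.toList

open scoped Classical in
/-- The paths from the source to `v`, in increasing order. -/
noncomputable def inPaths (v : Fin (n + 1)) : List (G.Path 0 v) :=
  (pathList G 0 v).mergeSort fun P Q => decide (F.InLE P Q)

open scoped Classical in
/-- The paths from `v` to the sink, in increasing order. -/
noncomputable def outPaths (v : Fin (n + 1)) : List (G.Path v (Fin.last n)) :=
  (pathList G v (Fin.last n)).mergeSort fun P Q => decide (F.OutLE P Q)

/-- The set of routes built from `C ∩ C'` by running through the incoming paths in decreasing order
and through the outgoing paths in increasing order, while avoiding `RemCCW C C'`. -/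
noncomputable def CmaxRem (C C' : Set G.Route) : Set G.Route :=
  F.greedy (fun v => (F.inPaths v).reverse) (fun v => F.outPaths v) (F.RemCCW C C') (C ∩ C')

/-- The set of routes built from `C ∩ C'` by running through the incoming paths in increasing order
and through the outgoing paths in decreasing order, while avoiding `RemCW C C'`. -/
noncomputable def CminRem (C C' : Set G.Route) : Set G.Route :=
  F.greedy (fun v => F.inPaths v) (fun v => (F.outPaths v).reverse) (F.RemCW C C') (C ∩ C')

end Algorithm

end Framing

end FlowGraph

/-! ### Walks and the comparison of lists of edges -/

/-! Call `r` the relation "clockwise at some vertex" between routes (`RouteCW`); cliques are the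
`r`-independent sets. The lattice structure comes from one abstract property of `r`. Let `leftFree r
S` be the set of routes clockwise from no element of `S`, and let `freeHull r S` be the set of its
elements from which no element of `leftFree r S` is clockwise. Interpolation (`IsInterpolative`)
says that whenever some `p` in `leftFree r S` is clockwise from `t`, some `k` in `freeHull r S` is
clockwise from `t`, and likewise with all relations reversed. Then each hull is a maximal clique
with the same `leftFree` as `S`, and each maximal clique is its own hull. So `C ↦ leftFree r C` is
injective on maximal cliques, and they are ordered by reverse inclusion. Since `leftFree r (C ∪ D)`
is the intersection of the two sets, `freeHull r (C ∪ D)` is the join; the hull for `flip r` is the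
meet.

Routes satisfy interpolation because two incoherent free routes may exchange their final parts and
stay free (`leftFree_splice`): an extremal free route therefore lies in the hull
(`exists_freeHull_through`).

This order is the rotation order. A rotation goes up, by inspecting the last vertex at which the two
exchanged routes are incoherent (`leftFree_subset_of_rotation`). Conversely, if `C` lies strictly
below `C'`, a shortest common part of a route of `C` clockwise from a route of `C'` leads to a
corner of `C`, and flipping this corner is a rotation that stays below `C'` (`exists_isCorner`,
`exists_rotation`).

Finally, `RemCCW C C'` is the complement of `rightFree r (leftFree r (C ∪ C'))` (`mem_RemCCW`). With
these routes excluded, the greedy algorithm can only select routes of the hull, and it finds all of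
them (`IsGreedyTarget.greedy_eq`). Mirror statements follow by passing to the framing `dual`. -/

/-- The strict relation on lists which compares the first entries after the longest common
initial part. -/
def PrefixLex {α : Type*} (r : α → α → Prop) (l m : List α) : Prop :=
  ∃ (c p q : List α) (e f : α), l = c ++ e :: p ∧ m = c ++ f :: q ∧ r e f

namespace PrefixLex

variable {α : Type*} {r : α → α → Prop}

theorem irrefl (hr : ∀ e, ¬ r e e) (l : List α) : ¬ PrefixLex r l l := by
  rintro ⟨c, p, q, e, f, h, h', hef⟩
  rw [h, List.append_cancel_left_eq] at h'
  cases h'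
  exact hr _ hef

theorem append_right {l m : List α} (h : PrefixLex r l m) (a b : List α) :
    PrefixLex r (l ++ a) (m ++ b) := by
  obtain ⟨c, p, q, e, f, rfl, rfl, hef⟩ := h
  exact ⟨c, p ++ a, q ++ b, e, f, by simp, by simp, hef⟩

theorem append_left {l m : List α} (h : PrefixLex r l m) (a : List α) :
    PrefixLex r (a ++ l) (a ++ m) := by
  obtain ⟨c, p, q, e, f, rfl, rfl, hef⟩ := h
  exact ⟨a ++ c, p, q, e, f, by simp, by simp, hef⟩

theorem cons_cons {a b : α} {l m : List α} :
    PrefixLex r (a :: l) (b :: m) ↔ r a b ∨ a = b ∧ PrefixLex r l m := by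
  constructor
  · rintro ⟨c, p, q, e, f, h, h', hef⟩
    cases c with
    | nil =>
      simp only [List.nil_append, List.cons.injEq] at h h'
      obtain ⟨rfl, rfl⟩ := h
      obtain ⟨rfl, rfl⟩ := h'
      exact Or.inl hef
    | cons x c =>
      simp only [List.cons_append, List.cons.injEq] at h h'
      obtain ⟨rfl, rfl⟩ := h
      obtain ⟨rfl, rfl⟩ := h'
      exact Or.inr ⟨rfl, c, p, q, e, f, rfl, rfl, hef⟩
  · rintro (h | ⟨rfl, h⟩)
    · exact ⟨[], l, m, a, b, rfl, rfl, h⟩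
    · exact h.append_left [a]

theorem not_nil_left {l : List α} : ¬ PrefixLex r [] l := by
  rintro ⟨c, p, q, e, f, h, -, -⟩
  simp at h

theorem not_nil_right {l : List α} : ¬ PrefixLex r l [] := by
  rintro ⟨c, p, q, e, f, -, h, -⟩
  simp at h

theorem cancel_left (hr : ∀ e, ¬ r e e) {a l m : List α}
    (h : PrefixLex r (a ++ l) (a ++ m)) : PrefixLex r l m := by
  induction a with
  | nil => exact h
  | cons x a ih =>
    rcases cons_cons.1 h with h | h
    · exact absurd h (hr x)
    · exact ih h.2

theorem trans (ht : ∀ e f g, r e f → r f g → r e g) {k l m : List α}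
    (h : PrefixLex r k l) (h' : PrefixLex r l m) : PrefixLex r k m := by
  induction k generalizing l m with
  | nil => exact absurd h not_nil_left
  | cons a k ih =>
    cases l with
    | nil => exact absurd h not_nil_right
    | cons b l =>
      cases m with
      | nil => exact absurd h' not_nil_right
      | cons c m =>
        rw [cons_cons] at h h' ⊢
        rcases h with h | ⟨rfl, h⟩ <;> rcases h' with h' | ⟨rfl, h'⟩
        · exact Or.inl (ht _ _ _ h h')
        · exact Or.inl h
        · exact Or.inl h'
        · exact Or.inr ⟨rfl, ih h h'⟩

end PrefixLex

namespace FlowGraph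

variable {n : ℕ} {E : Type*} {G : FlowGraph n E}

/-! ### Walks: endpoints and splittings -/

theorem IsWalk.split {u w : Fin (n + 1)} {l m : List E} (h : G.IsWalk u (l ++ m) w) :
    ∃ v, G.IsWalk u l v ∧ G.IsWalk v m w := by
  induction l generalizing u with
  | nil => exact ⟨u, rfl, h⟩
  | cons e l ih =>
    obtain ⟨v, hv, hv'⟩ := ih h.2
    exact ⟨v, ⟨h.1, hv⟩, hv'⟩

theorem IsWalk.split_cons {u w : Fin (n + 1)} {l m : List E} {e : E}
    (h : G.IsWalk u (l ++ e :: m) w) : G.IsWalk u l (G.src e) ∧ G.IsWalk (G.tgt e) m w := by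
  obtain ⟨v, hv, hv'⟩ := h.split
  exact ⟨hv'.1 ▸ hv, hv'.2⟩

theorem IsWalk.snoc {u : Fin (n + 1)} {l : List E} {e : E} (h : G.IsWalk u l (G.src e)) :
    G.IsWalk u (l ++ [e]) (G.tgt e) :=
  h.append ⟨rfl, rfl⟩

theorem IsWalk.end_unique {u v w : Fin (n + 1)} {l : List E} (h : G.IsWalk u l v)
    (h' : G.IsWalk u l w) : v = w := by
  induction l generalizing u with
  | nil => exact h.symm.trans h'
  | cons e l ih => exact ih h.2 h'.2

theorem IsWalk.start_unique {u v w : Fin (n + 1)} {l : List E} (h : G.IsWalk u l w)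
    (h' : G.IsWalk v l w) : u = v := by
  cases l with
  | nil => exact Eq.trans h (Eq.symm h')
  | cons e l => exact h.1.symm.trans h'.1

theorem IsWalk.le {u v : Fin (n + 1)} {l : List E} (h : G.IsWalk u l v) : u ≤ v := by
  induction l generalizing u with
  | nil => exact le_of_eq h
  | cons e l ih => exact (h.1 ▸ G.src_lt_tgt e).le.trans (ih h.2)

theorem IsWalk.lt {u v : Fin (n + 1)} {l : List E} (h : G.IsWalk u l v) (hl : l ≠ []) :
    u < v := by
  cases l with
  | nil => exact absurd rfl hl
  | cons e l => exact (h.1 ▸ G.src_lt_tgt e : u < G.tgt e).trans_le h.2.le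

theorem IsWalk.eq_nil {u : Fin (n + 1)} {l : List E} (h : G.IsWalk u l u) : l = [] := by
  by_contra hl
  exact lt_irrefl _ (h.lt hl)

/-- A walk passes through every vertex at most once. -/
theorem IsWalk.split_unique {u v : Fin (n + 1)} {x y x' y' : List E} (hx : G.IsWalk u x v)
    (hx' : G.IsWalk u x' v) (h : x ++ y = x' ++ y') : x = x' ∧ y = y' := by
  rcases List.append_eq_append_iff.1 h with ⟨a, rfl, rfl⟩ | ⟨a, rfl, rfl⟩
  · obtain ⟨w, hw, ha⟩ := hx'.split
    cases hw.end_unique hx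
    simp [ha.eq_nil]
  · obtain ⟨w, hw, ha⟩ := hx.split
    cases hw.end_unique hx'
    simp [ha.eq_nil]

theorem IsWalk.not_entering_zero {u : Fin (n + 1)} {l : List E} (h : G.IsWalk u l 0) :
    l = [] := by
  by_contra hl
  exact absurd (h.lt hl) (Fin.not_lt_zero u)

theorem IsWalk.not_leaving_last {v : Fin (n + 1)} {l : List E}
    (h : G.IsWalk (Fin.last n) l v) : l = [] := by
  by_contra hl
  exact absurd (h.lt hl) (Fin.le_last v).not_gt

namespace Framing

variable {F : G.Framing}

/-! ### Framing orders on edges and the induced orders on lists of edges -/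

theorem inEdgeLT_iff {e f : E} : F.InEdgeLT e f ↔
    ∃ (v : Fin (n + 1)) (he : G.tgt e = v) (hf : G.tgt f = v),
      (F.inOrder v).lt ⟨e, he⟩ ⟨f, hf⟩ := by
  constructor
  · rintro ⟨h, hlt⟩
    exact ⟨_, h, rfl, hlt⟩
  · rintro ⟨v, he, rfl, hlt⟩
    exact ⟨he, hlt⟩

theorem outEdgeLT_iff {e f : E} : F.OutEdgeLT e f ↔
    ∃ (v : Fin (n + 1)) (he : G.src e = v) (hf : G.src f = v),
      (F.outOrder v).lt ⟨e, he⟩ ⟨f, hf⟩ := by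
  constructor
  · rintro ⟨h, hlt⟩
    exact ⟨_, h, rfl, hlt⟩
  · rintro ⟨v, he, rfl, hlt⟩
    exact ⟨he, hlt⟩

theorem InEdgeLT.tgt_eq {e f : E} (h : F.InEdgeLT e f) : G.tgt e = G.tgt f := h.1

theorem OutEdgeLT.src_eq {e f : E} (h : F.OutEdgeLT e f) : G.src e = G.src f := h.1

theorem InEdgeLT.irrefl (e : E) : ¬ F.InEdgeLT e e := by
  rintro ⟨h, hlt⟩
  let := F.inOrder (G.tgt e)
  exact lt_irrefl _ hlt

theorem OutEdgeLT.irrefl (e : E) : ¬ F.OutEdgeLT e e := by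
  rintro ⟨h, hlt⟩
  let := F.outOrder (G.src e)
  exact lt_irrefl _ hlt

theorem InEdgeLT.trans (e f g : E) (h : F.InEdgeLT e f) (h' : F.InEdgeLT f g) :
    F.InEdgeLT e g := by
  rw [inEdgeLT_iff] at *
  obtain ⟨v, he, hf, hlt⟩ := h
  obtain ⟨w, hf', hg, hlt'⟩ := h'
  obtain rfl : v = w := hf.symm.trans hf'
  let := F.inOrder v
  exact ⟨v, he, hg, lt_trans hlt hlt'⟩

theorem OutEdgeLT.trans (e f g : E) (h : F.OutEdgeLT e f) (h' : F.OutEdgeLT f g) :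
    F.OutEdgeLT e g := by
  rw [outEdgeLT_iff] at *
  obtain ⟨v, he, hf, hlt⟩ := h
  obtain ⟨w, hf', hg, hlt'⟩ := h'
  obtain rfl : v = w := hf.symm.trans hf'
  let := F.outOrder v
  exact ⟨v, he, hg, lt_trans hlt hlt'⟩

variable (F) in
theorem inEdgeLT_trichotomy {e f : E} (h : G.tgt e = G.tgt f) :
    F.InEdgeLT e f ∨ e = f ∨ F.InEdgeLT f e := by
  let := F.inOrder (G.tgt f)
  rcases lt_trichotomy (⟨e, h⟩ : {e : E // G.tgt e = G.tgt f}) ⟨f, rfl⟩ with h' | h' | h'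
  · exact Or.inl ⟨h, h'⟩
  · exact Or.inr (Or.inl (congrArg Subtype.val h'))
  · exact Or.inr (Or.inr (inEdgeLT_iff.2 ⟨_, rfl, h, h'⟩))

variable (F) in
theorem outEdgeLT_trichotomy {e f : E} (h : G.src e = G.src f) :
    F.OutEdgeLT e f ∨ e = f ∨ F.OutEdgeLT f e := by
  let := F.outOrder (G.src f)
  rcases lt_trichotomy (⟨e, h⟩ : {e : E // G.src e = G.src f}) ⟨f, rfl⟩ with h' | h' | h'
  · exact Or.inl ⟨h, h'⟩
  · exact Or.inr (Or.inl (congrArg Subtype.val h'))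
  · exact Or.inr (Or.inr (outEdgeLT_iff.2 ⟨_, rfl, h, h'⟩))

variable (F)

/-- The order on lists of edges compared from the end. -/
def InListLT (l m : List E) : Prop :=
  ∃ (p q c : List E) (e f : E), l = p ++ e :: c ∧ m = q ++ f :: c ∧ F.InEdgeLT e f

/-- The order on lists of edges compared from the beginning. -/
def OutListLT (l m : List E) : Prop := PrefixLex F.OutEdgeLT l m

/-- The list `l` is clockwise from the list `m`: the two lists have a common part `c`, such that
`l` enters `c` before `m` and leaves it after `m`. -/
def ListCW (l m : List E) : Prop :=
  ∃ (p c q p' q' : List E) (e f e' f' : E), l = p ++ e :: (c ++ f :: q) ∧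
    m = p' ++ e' :: (c ++ f' :: q') ∧ F.InEdgeLT e e' ∧ F.OutEdgeLT f' f

variable {F}

/-- Reversal turns comparison from the end into `PrefixLex`, so order properties need only one
proof. -/
theorem inListLT_iff_reverse {l m : List E} :
    F.InListLT l m ↔ PrefixLex F.InEdgeLT l.reverse m.reverse := by
  constructor
  · rintro ⟨p, q, c, e, f, rfl, rfl, h⟩
    exact ⟨c.reverse, p.reverse, q.reverse, e, f, by simp, by simp, h⟩
  · rintro ⟨c, p, q, e, f, h, h', hef⟩
    refine ⟨p.reverse, q.reverse, c.reverse, e, f, ?_, ?_, hef⟩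
    · simpa using congrArg List.reverse h
    · simpa using congrArg List.reverse h'

theorem InListLT.irrefl (l : List E) : ¬ F.InListLT l l := by
  rw [inListLT_iff_reverse]
  exact PrefixLex.irrefl InEdgeLT.irrefl _

theorem InListLT.trans {k l m : List E} (h : F.InListLT k l) (h' : F.InListLT l m) :
    F.InListLT k m := by
  rw [inListLT_iff_reverse] at *
  exact h.trans InEdgeLT.trans h'

theorem InListLT.asymm {l m : List E} (h : F.InListLT l m) : ¬ F.InListLT m l :=
  fun h' => InListLT.irrefl _ (h.trans h')

theorem InListLT.append_left {l m : List E} (h : F.InListLT l m) (a b : List E) :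
    F.InListLT (a ++ l) (b ++ m) := by
  obtain ⟨p, q, c, e, f, rfl, rfl, hef⟩ := h
  exact ⟨a ++ p, b ++ q, c, e, f, by simp, by simp, hef⟩

theorem InListLT.append_right {l m : List E} (h : F.InListLT l m) (a : List E) :
    F.InListLT (l ++ a) (m ++ a) := by
  obtain ⟨p, q, c, e, f, rfl, rfl, hef⟩ := h
  exact ⟨p, q, c ++ a, e, f, by simp, by simp, hef⟩

theorem InListLT.cancel_right {a l m : List E} (h : F.InListLT (l ++ a) (m ++ a)) :
    F.InListLT l m := by
  rw [inListLT_iff_reverse] at *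
  rw [List.reverse_append, List.reverse_append] at h
  exact h.cancel_left InEdgeLT.irrefl

theorem OutListLT.irrefl (l : List E) : ¬ F.OutListLT l l :=
  PrefixLex.irrefl OutEdgeLT.irrefl _

theorem OutListLT.trans {k l m : List E} (h : F.OutListLT k l) (h' : F.OutListLT l m) :
    F.OutListLT k m :=
  PrefixLex.trans OutEdgeLT.trans h h'

theorem OutListLT.asymm {l m : List E} (h : F.OutListLT l m) : ¬ F.OutListLT m l :=
  fun h' => OutListLT.irrefl _ (h.trans h')

theorem OutListLT.append_right {l m : List E} (h : F.OutListLT l m) (a b : List E) :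
    F.OutListLT (l ++ a) (m ++ b) := PrefixLex.append_right h a b

theorem OutListLT.append_left {l m : List E} (h : F.OutListLT l m) (a : List E) :
    F.OutListLT (a ++ l) (a ++ m) := PrefixLex.append_left h a

theorem OutListLT.of_edge {e f : E} (h : F.OutEdgeLT e f) (l m : List E) :
    F.OutListLT (e :: l) (f :: m) := ⟨[], l, m, e, f, rfl, rfl, h⟩

theorem InListLT.of_edge {e f : E} (h : F.InEdgeLT e f) (l m c : List E) :
    F.InListLT (l ++ e :: c) (m ++ f :: c) := ⟨l, m, c, e, f, rfl, rfl, h⟩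

/-- Comparable lists end at the same vertex. -/
theorem InListLT.end_eq {a b v w : Fin (n + 1)} {l m : List E} (h : F.InListLT l m)
    (hl : G.IsWalk a l v) (hm : G.IsWalk b m w) : v = w := by
  obtain ⟨p, q, c, e, f, rfl, rfl, hef⟩ := h
  have h1 := hl.split_cons.2
  have h2 := hm.split_cons.2
  rw [hef.tgt_eq] at h1
  exact h1.end_unique h2

variable (F) in
theorem outListLT_trichotomy_prefix {u a b : Fin (n + 1)} {l m : List E} (hl : G.IsWalk u l a)
    (hm : G.IsWalk u m b) : F.OutListLT l m ∨ F.OutListLT m l ∨ l <+: m ∨ m <+: l := by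
  induction l generalizing u m with
  | nil => simp
  | cons e l ih =>
    cases m with
    | nil => simp
    | cons f m =>
      rcases F.outEdgeLT_trichotomy (hl.1.trans hm.1.symm) with h | rfl | h
      · exact Or.inl (OutListLT.of_edge h _ _)
      · rcases ih hl.2 hm.2 with h | h | h | h
        · exact Or.inl (h.append_left [e])
        · exact Or.inr (Or.inl (h.append_left [e]))
        · exact Or.inr (Or.inr (Or.inl (by simpa using h)))
        · exact Or.inr (Or.inr (Or.inr (by simpa using h)))
      · exact Or.inr (Or.inl (OutListLT.of_edge h _ _))

-- Nothing leaves the sink, so a prefix relation between two such walks is an equality.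
variable (F) in
theorem outListLT_trichotomy {u : Fin (n + 1)} {l m : List E} (hl : G.IsWalk u l (Fin.last n))
    (hm : G.IsWalk u m (Fin.last n)) : F.OutListLT l m ∨ l = m ∨ F.OutListLT m l := by
  rcases F.outListLT_trichotomy_prefix hl hm with h | h | ⟨t, rfl⟩ | ⟨t, rfl⟩
  · exact Or.inl h
  · exact Or.inr (Or.inr h)
  · obtain ⟨v, hv, ht⟩ := hm.split
    cases hv.end_unique hl
    simp [ht.not_leaving_last]
  · obtain ⟨v, hv, ht⟩ := hl.split
    cases hv.end_unique hm
    simp [ht.not_leaving_last]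

variable (F) in
theorem inListLT_trichotomy_suffix {v a b : Fin (n + 1)} {l m : List E} (hl : G.IsWalk a l v)
    (hm : G.IsWalk b m v) : F.InListLT l m ∨ F.InListLT m l ∨ l <:+ m ∨ m <:+ l := by
  induction l using List.reverseRecOn generalizing v m with
  | nil => simp
  | append_singleton l e ih =>
    induction m using List.reverseRecOn with
    | nil => simp
    | append_singleton m f _ =>
      have hle := hl.split_cons
      have hmf := hm.split_cons
      have ht : G.tgt e = G.tgt f := Eq.trans hle.2 (Eq.symm hmf.2)
      rcases F.inEdgeLT_trichotomy ht with h | rfl | h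
      · exact Or.inl (InListLT.of_edge h _ _ _)
      · rcases ih hle.1 hmf.1 with h | h | ⟨t, rfl⟩ | ⟨t, rfl⟩
        · exact Or.inl (h.append_right [e])
        · exact Or.inr (Or.inl (h.append_right [e]))
        · exact Or.inr (Or.inr (Or.inl ⟨t, by simp⟩))
        · exact Or.inr (Or.inr (Or.inr ⟨t, by simp⟩))
      · exact Or.inr (Or.inl (InListLT.of_edge h _ _ _))

variable (F) in
theorem inListLT_trichotomy {v : Fin (n + 1)} {l m : List E} (hl : G.IsWalk 0 l v)
    (hm : G.IsWalk 0 m v) : F.InListLT l m ∨ l = m ∨ F.InListLT m l := by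
  rcases F.inListLT_trichotomy_suffix hl hm with h | h | ⟨t, rfl⟩ | ⟨t, rfl⟩
  · exact Or.inl h
  · exact Or.inr (Or.inr h)
  · obtain ⟨v, ht, hv⟩ := hm.split
    cases hv.start_unique hl
    simp [ht.not_entering_zero]
  · obtain ⟨v, ht, hv⟩ := hl.split
    cases hv.start_unique hm
    simp [ht.not_entering_zero]

/-! ### The clockwise relation on lists of edges -/

theorem ListCW.of_split {x y x' y' : List E} (h : F.InListLT x x') (h' : F.OutListLT y' y) :
    F.ListCW (x ++ y) (x' ++ y') := by
  obtain ⟨p, q, c, e, e', rfl, rfl, he⟩ := h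
  obtain ⟨c', p', q', f', f, rfl, rfl, hf⟩ := h'
  exact ⟨p, c ++ c', q', q, p', e, f, e', f', by simp, by simp, he, hf⟩

theorem ListCW.exists_split {l m : List E} (h : F.ListCW l m) :
    ∃ x y x' y', l = x ++ y ∧ m = x' ++ y' ∧ F.InListLT x x' ∧ F.OutListLT y' y := by
  obtain ⟨p, c, q, p', q', e, f, e', f', rfl, rfl, he, hf⟩ := h
  exact ⟨p ++ [e], c ++ f :: q, p' ++ [e'], c ++ f' :: q', by simp, by simp,
    InListLT.of_edge he _ _ _, (OutListLT.of_edge hf _ _).append_left c⟩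

theorem ListCW.mono {l m : List E} (h : F.ListCW l m) (a b a' b' : List E) :
    F.ListCW (a ++ l ++ b) (a' ++ m ++ b') := by
  obtain ⟨p, c, q, p', q', e, f, e', f', rfl, rfl, he, hf⟩ := h
  exact ⟨a ++ p, c, q ++ b, a' ++ p', q' ++ b', e, f, e', f', by simp, by simp, he, hf⟩

theorem ListCW.append_right {l m : List E} (h : F.ListCW l m) (b : List E) :
    F.ListCW l (m ++ b) := by
  simpa using h.mono [] [] [] b

theorem ListCW.append_left {l m : List E} (h : F.ListCW l m) (a : List E) :
    F.ListCW l (a ++ m) := by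
  simpa using h.mono [] [] a []

theorem ListCW.right_append {l m : List E} (h : F.ListCW l m) (b : List E) :
    F.ListCW (l ++ b) m := by
  simpa using h.mono [] b [] []

theorem ListCW.left_append {l m : List E} (h : F.ListCW l m) (a : List E) :
    F.ListCW (a ++ l) m := by
  simpa using h.mono a [] [] []

/-- If `z` is clockwise from a concatenation, then this happens at the point of concatenation or
inside one of the two parts. -/
theorem ListCW.of_append_right {z x y : List E} (h : F.ListCW z (x ++ y)) :
    (∃ z₁ z₂, z = z₁ ++ z₂ ∧ F.InListLT z₁ x ∧ F.OutListLT y z₂) ∨ F.ListCW z x ∨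
      F.ListCW z y := by
  obtain ⟨p, c, q, p', q', e, f, e', f', rfl, hm, he, hf⟩ := h
  rcases List.append_eq_append_iff.1 hm with ⟨a, rfl, rfl⟩ | ⟨a, rfl, ha⟩
  · exact Or.inr (Or.inr ⟨p, c, q, a, q', e, f, e', f', rfl, rfl, he, hf⟩)
  cases a with
  | nil => exact Or.inr (Or.inr ⟨p, c, q, [], q', e, f, e', f', rfl, ha.symm, he, hf⟩)
  | cons g a =>
    simp only [List.cons_append, List.cons.injEq] at ha
    obtain ⟨rfl, ha⟩ := ha
    rcases List.append_eq_append_iff.1 ha with ⟨b, rfl, hb⟩ | ⟨b, rfl, rfl⟩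
    · cases b with
      | nil =>
        refine Or.inl ⟨p ++ e :: c, f :: q, by simp, ?_, ?_⟩
        · simpa using InListLT.of_edge he p p' c
        · simp only [List.nil_append] at hb
          exact hb ▸ OutListLT.of_edge hf _ _
      | cons g b =>
        simp only [List.cons_append, List.cons.injEq] at hb
        obtain ⟨rfl, rfl⟩ := hb
        exact Or.inr (Or.inl ⟨p, c, q, p', b, e, f, e', f', rfl, by simp, he, hf⟩)
    · refine Or.inl ⟨p ++ e :: a, b ++ f :: q, by simp, ?_, ?_⟩
      · exact InListLT.of_edge he p p' a
      · exact (OutListLT.of_edge hf _ _).append_left b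

/-! ### Duality between clockwise and counterclockwise -/

variable (F)

/-- The framing with all orders reversed. It interchanges clockwise and counterclockwise. -/
def dual : G.Framing where
  inOrder v := @OrderDual.instLinearOrder _ (F.inOrder v)
  outOrder v := @OrderDual.instLinearOrder _ (F.outOrder v)

variable {F}

theorem dual_inEdgeLT {e f : E} : F.dual.InEdgeLT e f ↔ F.InEdgeLT f e := by
  rw [inEdgeLT_iff, inEdgeLT_iff]
  constructor
  · rintro ⟨v, he, hf, h⟩
    exact ⟨v, hf, he, h⟩
  · rintro ⟨v, he, hf, h⟩
    exact ⟨v, hf, he, h⟩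

theorem dual_outEdgeLT {e f : E} : F.dual.OutEdgeLT e f ↔ F.OutEdgeLT f e := by
  rw [outEdgeLT_iff, outEdgeLT_iff]
  constructor
  · rintro ⟨v, he, hf, h⟩
    exact ⟨v, hf, he, h⟩
  · rintro ⟨v, he, hf, h⟩
    exact ⟨v, hf, he, h⟩

theorem dual_inListLT {l m : List E} : F.dual.InListLT l m ↔ F.InListLT m l := by
  constructor
  · rintro ⟨p, q, c, e, f, hl, hm, h⟩
    exact ⟨q, p, c, f, e, hm, hl, dual_inEdgeLT.1 h⟩
  · rintro ⟨p, q, c, e, f, hl, hm, h⟩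
    exact ⟨q, p, c, f, e, hm, hl, dual_inEdgeLT.2 h⟩

theorem dual_outListLT {l m : List E} : F.dual.OutListLT l m ↔ F.OutListLT m l := by
  constructor
  · rintro ⟨c, p, q, e, f, hl, hm, h⟩
    exact ⟨c, q, p, f, e, hm, hl, dual_outEdgeLT.1 h⟩
  · rintro ⟨c, p, q, e, f, hl, hm, h⟩
    exact ⟨c, q, p, f, e, hm, hl, dual_outEdgeLT.2 h⟩

theorem dual_listCW {l m : List E} : F.dual.ListCW l m ↔ F.ListCW m l := by
  constructor
  · rintro ⟨p, c, q, p', q', e, f, e', f', hl, hm, he, hf⟩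
    exact ⟨p', c, q', p, q, e', f', e, f, hm, hl, dual_inEdgeLT.1 he, dual_outEdgeLT.1 hf⟩
  · rintro ⟨p, c, q, p', q', e, f, e', f', hl, hm, he, hf⟩
    exact ⟨p', c, q', p, q, e', f', e, f, hm, hl, dual_inEdgeLT.2 he, dual_outEdgeLT.2 hf⟩

theorem ListCW.of_append_left {z x y : List E} (h : F.ListCW (x ++ y) z) :
    (∃ z₁ z₂, z = z₁ ++ z₂ ∧ F.InListLT x z₁ ∧ F.OutListLT z₂ y) ∨ F.ListCW x z ∨
      F.ListCW y z := by
  simpa only [dual_listCW, dual_inListLT, dual_outListLT] using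
    ListCW.of_append_right (dual_listCW.2 h)

/-- A walk splits at a given vertex in only one way, so the two initial parts being compared
coincide. -/
theorem ListCW.irrefl {a b : Fin (n + 1)} {l : List E} (hl : G.IsWalk a l b) :
    ¬ F.ListCW l l := by
  intro h
  obtain ⟨x, y, x', y', h1, h2, hx, -⟩ := h.exists_split
  obtain ⟨v, hv, -⟩ := (h1 ▸ hl).split
  obtain ⟨w, hw, -⟩ := (h2 ▸ hl).split
  cases hx.end_eq hv hw
  cases (hv.split_unique hw (h1.symm.trans h2)).1
  exact InListLT.irrefl _ hx

/-- For paths, being clockwise at some vertex is expressed by the lists of edges alone. -/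
theorem exists_cw_iff {a b c d : Fin (n + 1)} {P : G.Path a b} {Q : G.Path c d} :
    (∃ v, F.CW v P Q) ↔ F.ListCW P.1 Q.1 := by
  constructor
  · rintro ⟨v, Pv, vP, Qv, vQ, rfl, rfl, h1, h2⟩
    exact ListCW.of_split h1 h2
  · intro h
    obtain ⟨x, y, x', y', hP, hQ, hx, hy⟩ := h.exists_split
    obtain ⟨v, hv, hv'⟩ := (hP ▸ P.2).split
    obtain ⟨w, hw, hw'⟩ := (hQ ▸ Q.2).split
    cases hx.end_eq hv hw
    exact ⟨v, ⟨x, hv⟩, ⟨y, hv'⟩, ⟨x', hw⟩, ⟨y', hw'⟩, Subtype.ext hP, Subtype.ext hQ, hx, hy⟩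

end Framing

end FlowGraph

/-! ### Maximal independent sets of an interpolative relation -/

section Interpolative

variable {α : Type*}

/-- The elements which are not related to any element of `S`. -/
def leftFree (r : α → α → Prop) (S : Set α) : Set α := {q | ∀ s ∈ S, ¬ r q s}

/-- The elements to which no element of `S` is related. -/
def rightFree (r : α → α → Prop) (S : Set α) : Set α := {t | ∀ s ∈ S, ¬ r s t}

/-- The elements of `leftFree r S` to which no element of `leftFree r S` is related. -/
def freeHull (r : α → α → Prop) (S : Set α) : Set α := leftFree r S ∩ rightFree r (leftFree r S)

/-- A set of pairwise unrelated elements. -/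
def IsIndependent (r : α → α → Prop) (C : Set α) : Prop := ∀ a ∈ C, ∀ b ∈ C, ¬ r a b

/-- An irreflexive relation for which relations starting in `leftFree r S`, or ending in
`rightFree r S`, factor through the corresponding hull. -/
structure IsInterpolative (r : α → α → Prop) : Prop where
  irrefl : ∀ a, ¬ r a a
  exists_left : ∀ S : Set α, ∀ p ∈ leftFree r S, ∀ t, r p t → ∃ k ∈ freeHull r S, r k t
  exists_right : ∀ S : Set α, ∀ p ∈ rightFree r S, ∀ t, r t p → ∃ k ∈ freeHull (flip r) S, r t k

variable {r : α → α → Prop}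

theorem subset_rightFree_leftFree (S : Set α) : S ⊆ rightFree r (leftFree r S) :=
  fun s hs _ hq => hq s hs

/-- The pair `leftFree`, `rightFree` is a Galois connection, so applying it three times to `S` gives
`leftFree r S` again. This makes the hull symmetric and lets both halves of interpolation apply to
it. -/
theorem freeHull_flip_leftFree (S : Set α) : freeHull (flip r) (leftFree r S) = freeHull r S := by
  ext t
  constructor
  · rintro ⟨h1, h2⟩
    exact ⟨fun s hs => h2 s (subset_rightFree_leftFree S hs), h1⟩
  · rintro ⟨h1, h2⟩
    exact ⟨h2, fun s hs => hs t h1⟩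

theorem isIndependent_flip {C : Set α} : IsIndependent (flip r) C ↔ IsIndependent r C :=
  ⟨fun h a ha b hb => h b hb a ha, fun h a ha b hb => h b hb a ha⟩

theorem maximal_isIndependent_flip {C : Set α} :
    Maximal (IsIndependent (flip r)) C ↔ Maximal (IsIndependent r) C := by
  have : IsIndependent (flip r) = IsIndependent r :=
    funext fun C => propext isIndependent_flip
  rw [this]

namespace IsInterpolative

theorem flip (hr : IsInterpolative r) : IsInterpolative (flip r) :=
  ⟨hr.irrefl, hr.exists_right, hr.exists_left⟩

/-- Here `t` is related to some `s ∈ S`, and `S` lies in `rightFree r (leftFree r S)`; the right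
half of interpolation, applied to `leftFree r S`, replaces `s` by an element of the hull. -/
theorem exists_freeHull_of_notMem (hr : IsInterpolative r) {S : Set α} {t : α}
    (ht : t ∉ leftFree r S) : ∃ k ∈ freeHull r S, r t k := by
  simp only [leftFree, Set.mem_ofPred_eq, not_forall, not_not] at ht
  obtain ⟨s, hs, hts⟩ := ht
  rw [← freeHull_flip_leftFree]
  exact hr.exists_right _ s (subset_rightFree_leftFree S hs) t hts

theorem leftFree_freeHull (hr : IsInterpolative r) (S : Set α) :
    leftFree r (freeHull r S) = leftFree r S := by
  ext q
  constructor
  · intro h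
    by_contra hq
    obtain ⟨k, hk, hqk⟩ := hr.exists_freeHull_of_notMem hq
    exact h k hk hqk
  · intro h k hk
    exact hk.2 q h

theorem mem_of_maximal (hr : IsInterpolative r) {C : Set α} (hC : Maximal (IsIndependent r) C)
    {t : α} (h : ∀ c ∈ C, ¬ r t c ∧ ¬ r c t) : t ∈ C := by
  have hi : IsIndependent r (insert t C) := by
    rintro a (rfl | ha) b (rfl | hb)
    · exact hr.irrefl _
    · exact (h b hb).1
    · exact (h a ha).2
    · exact hC.prop a ha b hb
  exact hC.le_of_ge hi (Set.subset_insert t C) (Set.mem_insert t C)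

/-- An element `t` unrelated to the hull lies in `leftFree r S` by the right half of interpolation,
and nothing in `leftFree r S` is related to it by the left half. -/
theorem maximal_freeHull (hr : IsInterpolative r) (S : Set α) :
    Maximal (IsIndependent r) (freeHull r S) := by
  refine ⟨fun a ha b hb => hb.2 a ha.1, fun D hD hle t ht => ?_⟩
  have h1 : t ∈ leftFree r S := by
    by_contra h
    obtain ⟨k, hk, htk⟩ := hr.exists_freeHull_of_notMem h
    exact hD t ht k (hle hk) htk
  refine ⟨h1, fun q hq hqt => ?_⟩
  obtain ⟨k, hk, hkt⟩ := hr.exists_left S q hq t hqt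
  exact hD k (hle hk) t ht hkt

theorem freeHull_eq (hr : IsInterpolative r) {C : Set α} (hC : Maximal (IsIndependent r) C) :
    freeHull r C = C := by
  have h : C ⊆ freeHull r C := fun c hc => ⟨hC.prop c hc, fun q hq => hq c hc⟩
  exact (hC.le_of_ge (hr.maximal_freeHull C).prop h).antisymm h

/-- Compares two maximal sets through pairs of their elements. If a free `p` is related to `c ∈ C`,
interpolation moves `p` into the hull of `D`, which is `D`. -/
theorem leftFree_subset_iff (hr : IsInterpolative r) {C D : Set α}
    (hD : Maximal (IsIndependent r) D) :
    leftFree r D ⊆ leftFree r C ↔ ∀ c ∈ C, ∀ d ∈ D, ¬ r d c := by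
  constructor
  · exact fun h c hc d hd => h (hD.prop d hd) c hc
  · intro h p hp c hc hpc
    obtain ⟨k, hk, hkc⟩ := hr.exists_left D p hp c hpc
    exact h c hc k (hr.freeHull_eq hD ▸ hk) hkc

theorem rightFree_subset_iff (hr : IsInterpolative r) {C D : Set α}
    (hC : Maximal (IsIndependent r) C) :
    rightFree r C ⊆ rightFree r D ↔ ∀ c ∈ C, ∀ d ∈ D, ¬ r d c :=
  (hr.flip.leftFree_subset_iff (maximal_isIndependent_flip.2 hC)).trans
    ⟨fun h c hc d hd => h d hd c hc, fun h d hd c hc => h c hc d hd⟩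

/-- The order on maximal independent sets. -/
theorem leftFree_subset_iff_rightFree (hr : IsInterpolative r) {C D : Set α}
    (hC : Maximal (IsIndependent r) C) (hD : Maximal (IsIndependent r) D) :
    leftFree r D ⊆ leftFree r C ↔ rightFree r C ⊆ rightFree r D :=
  (hr.leftFree_subset_iff hD).trans (hr.rightFree_subset_iff hC).symm

theorem eq_of_leftFree_eq (hr : IsInterpolative r) {C D : Set α}
    (hC : Maximal (IsIndependent r) C) (hD : Maximal (IsIndependent r) D)
    (h : leftFree r C = leftFree r D) : C = D := by
  rw [← hr.freeHull_eq hC, ← hr.freeHull_eq hD, freeHull, freeHull, h]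

theorem maximal_freeHull_flip (hr : IsInterpolative r) (S : Set α) :
    Maximal (IsIndependent r) (freeHull (_root_.flip r) S) :=
  maximal_isIndependent_flip.1 (hr.flip.maximal_freeHull S)

theorem rightFree_freeHull_flip (hr : IsInterpolative r) (S : Set α) :
    rightFree r (freeHull (_root_.flip r) S) = rightFree r S :=
  hr.flip.leftFree_freeHull S

end IsInterpolative

theorem leftFree_union (S T : Set α) : leftFree r (S ∪ T) = leftFree r S ∩ leftFree r T := by
  ext q
  exact ⟨fun h => ⟨fun s hs => h s (Or.inl hs), fun s hs => h s (Or.inr hs)⟩,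
    fun h s hs => hs.elim (h.1 s) (h.2 s)⟩

theorem rightFree_union (S T : Set α) :
    rightFree r (S ∪ T) = rightFree r S ∩ rightFree r T := by
  ext q
  exact ⟨fun h => ⟨fun s hs => h s (Or.inl hs), fun s hs => h s (Or.inr hs)⟩,
    fun h s hs => hs.elim (h.1 s) (h.2 s)⟩

end Interpolative

/-! ### The clockwise relation between routes is interpolative -/

namespace FlowGraph

variable {n : ℕ} {E : Type*} {G : FlowGraph n E}

namespace Framing

variable {F : G.Framing}

variable (F) in
/-- The relation "clockwise at some vertex" between routes. -/
def RouteCW (P Q : G.Route) : Prop := F.ListCW P.1 Q.1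

theorem routeCW_dual : F.dual.RouteCW = flip F.RouteCW := by
  funext P Q
  exact propext dual_listCW

/-- Two routes one of which is clockwise from the other can exchange their parts without
losing freeness. -/
theorem leftFree_splice {S : Set G.Route} {P Q : G.Route} {x y x' y' : List E}
    (hP : P ∈ leftFree F.RouteCW S) (hQ : Q ∈ leftFree F.RouteCW S) (hPe : P.1 = x ++ y)
    (hQe : Q.1 = x' ++ y') (hx : F.InListLT x' x) (hy : F.OutListLT y y') {R : G.Route}
    (hR : R.1 = x' ++ y ∨ R.1 = x ++ y') : R ∈ leftFree F.RouteCW S := by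
  intro s hs hRs
  have h1 := hP s hs
  have h2 := hQ s hs
  simp only [RouteCW, hPe, hQe] at h1 h2
  rw [RouteCW] at hRs
  -- A relation at the splicing vertex passes by transitivity to `Q`, which is there at least as far
  -- clockwise as either spliced route. Any other relation lies inside a part of `P` or `Q`.
  rcases hR with hR | hR <;> rw [hR] at hRs
  · rcases hRs.of_append_left with ⟨z₁, z₂, hz, h, h'⟩ | h | h
    · exact h2 (hz ▸ ListCW.of_split h (h'.trans hy))
    · exact h2 (h.right_append _)
    · exact h1 (h.left_append _)
  · rcases hRs.of_append_left with ⟨z₁, z₂, hz, h, h'⟩ | h | h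
    · exact h2 (hz ▸ ListCW.of_split (hx.trans h) h')
    · exact h1 (h.right_append _)
    · exact h2 (h.left_append _)

theorem rightFree_splice {S : Set G.Route} {P Q : G.Route} {x y x' y' : List E}
    (hP : P ∈ rightFree F.RouteCW S) (hQ : Q ∈ rightFree F.RouteCW S) (hPe : P.1 = x ++ y)
    (hQe : Q.1 = x' ++ y') (hx : F.InListLT x x') (hy : F.OutListLT y' y) {R : G.Route}
    (hR : R.1 = x' ++ y ∨ R.1 = x ++ y') : R ∈ rightFree F.RouteCW S := by
  have h : ∀ R, R ∈ rightFree F.RouteCW S ↔ R ∈ leftFree F.dual.RouteCW S := by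
    intro R
    rw [routeCW_dual]
    rfl
  rw [h] at *
  exact leftFree_splice hP hQ hPe hQe (dual_inListLT.2 hx) (dual_outListLT.2 hy) hR

section Finite

variable [Finite E]

variable (F) in
theorem wellFounded_inListLT (u v : Fin (n + 1)) :
    WellFounded fun a b : G.Path u v => F.InListLT a.1 b.1 := by
  have : IsTrans (G.Path u v) fun a b => F.InListLT a.1 b.1 := ⟨fun _ _ _ h h' => h.trans h'⟩
  have : Std.Irrefl fun a b : G.Path u v => F.InListLT a.1 b.1 := ⟨fun _ => InListLT.irrefl _⟩
  exact Finite.wellFounded_of_trans_of_irrefl _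

variable (F) in
theorem wellFounded_outListLT (u v : Fin (n + 1)) :
    WellFounded fun a b : G.Path u v => F.OutListLT a.1 b.1 := by
  have : IsTrans (G.Path u v) fun a b => F.OutListLT a.1 b.1 := ⟨fun _ _ _ h h' => h.trans h'⟩
  have : Std.Irrefl fun a b : G.Path u v => F.OutListLT a.1 b.1 :=
    ⟨fun _ => OutListLT.irrefl _⟩
  exact Finite.wellFounded_of_trans_of_irrefl _

variable (F) in
theorem wellFounded_inListLT_swap (u v : Fin (n + 1)) :
    WellFounded fun a b : G.Path u v => F.InListLT b.1 a.1 := by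
  simpa only [dual_inListLT] using F.dual.wellFounded_inListLT u v

variable (F) in
theorem wellFounded_outListLT_swap (u v : Fin (n + 1)) :
    WellFounded fun a b : G.Path u v => F.OutListLT b.1 a.1 := by
  simpa only [dual_outListLT] using F.dual.wellFounded_outListLT u v

/-- A free route through a path `M` with at most one edge can be moved clockwise, keeping `M`,
into the hull. -/
theorem exists_freeHull_through {S : Set G.Route} {u v : Fin (n + 1)} {M : List E}
    (hM : G.IsWalk u M v) (hlen : M.length ≤ 1) (x : G.Path 0 u) (y : G.Path v (Fin.last n))
    {p : G.Route} (hp : p ∈ leftFree F.RouteCW S) (hpe : p.1 = x.1 ++ (M ++ y.1)) :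
    ∃ k ∈ freeHull F.RouteCW S, ∃ (x' : G.Path 0 u) (y' : G.Path v (Fin.last n)),
      k.1 = x'.1 ++ (M ++ y'.1) ∧ (x' = x ∨ F.InListLT x'.1 x.1) ∧
      (y' = y ∨ F.OutListLT y.1 y'.1) := by
  -- First `x₀` is minimal over all admissible final parts, then `y₀` is maximal with `x₀` fixed. A
  -- free route clockwise from the result could be spliced with it: if their entering edges differ
  -- inside `x₀`, this lowers `x₀`, and otherwise it raises `y₀`.
  obtain ⟨x₀, ⟨hx₀, y₁, hy₁, k₁, hk₁, hk₁e⟩, hxmin⟩ := (F.wellFounded_inListLT 0 u).has_min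
    {x' | (x' = x ∨ F.InListLT x'.1 x.1) ∧ ∃ y' : G.Path v (Fin.last n),
      (y' = y ∨ F.OutListLT y.1 y'.1) ∧
      ∃ k ∈ leftFree F.RouteCW S, k.1 = x'.1 ++ (M ++ y'.1)}
    ⟨x, Or.inl rfl, y, Or.inl rfl, p, hp, hpe⟩
  obtain ⟨y₀, ⟨hy₀, k, hk, hke⟩, hymax⟩ := (F.wellFounded_outListLT_swap v (Fin.last n)).has_min
    {y' | (y' = y ∨ F.OutListLT y.1 y'.1) ∧
      ∃ k ∈ leftFree F.RouteCW S, k.1 = x₀.1 ++ (M ++ y'.1)}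
    ⟨y₁, hy₁, k₁, hk₁, hk₁e⟩
  refine ⟨k, ⟨hk, fun q hq hqk => ?_⟩, x₀, y₀, hke, hx₀, hy₀⟩
  obtain ⟨p', c, q', P, Q, e', f', e, f, hqe, hke', he, hf⟩ := hqk
  have hqw := q.2
  have hkw := k.2
  rw [hqe] at hqw
  rw [hke'] at hkw
  have hq1 := hqw.split_cons
  have hq2 := hq1.2.split_cons
  have hk1 := hkw.split_cons
  have hk2 := hk1.2.split_cons
  -- moving the part of the route before `e`
  have key1 : ∀ a, x₀.1 = P ++ e :: a → False := by
    intro a ha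
    have hw := x₀.2
    rw [ha] at hw
    have hw' : G.IsWalk 0 (p' ++ e' :: a) u :=
      hq1.1.append ⟨rfl, he.tgt_eq ▸ hw.split_cons.2⟩
    have hlt : F.InListLT (p' ++ e' :: a) x₀.1 := ha ▸ InListLT.of_edge he _ _ _
    refine hxmin ⟨p' ++ e' :: a, hw'⟩ ⟨Or.inr ?_, y₀, hy₀,
      ⟨(p' ++ e' :: a) ++ (M ++ y₀.1), hw'.append (hM.append y₀.2)⟩, ?_, rfl⟩ hlt
    · rcases hx₀ with rfl | h
      · exact hlt
      · exact hlt.trans h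
    · have h3 : c ++ f :: Q = a ++ (M ++ y₀.1) := by
        have := hke.symm.trans hke'
        rw [ha] at this
        simpa using this.symm
      refine leftFree_splice hk hq (x := P ++ [e]) (y := c ++ f :: Q) (x' := p' ++ [e'])
        (y' := c ++ f' :: q') (by simpa using hke') (by simpa using hqe)
        (InListLT.of_edge he _ _ _) ((OutListLT.of_edge hf _ _).append_left c) (Or.inl ?_)
      simp [h3]
  -- moving the part of the route after `f`
  have key2 : ∀ a, M ++ y₀.1 = a ++ e :: (c ++ f :: Q) → P = x₀.1 ++ a → False := by
    intro a ha hP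
    have h3 : M ++ y₀.1 = (a ++ e :: c) ++ f :: Q := by simpa using ha
    rcases List.append_eq_append_iff.1 h3 with ⟨b, hb, hy⟩ | ⟨b, hb, hy⟩
    · have hw := y₀.2
      rw [hy] at hw
      have hw1 := hw.split_cons
      have hw' : G.IsWalk v (b ++ f' :: q') (Fin.last n) :=
        hw1.1.append ⟨hf.src_eq.symm, hq2.2⟩
      have hlt : F.OutListLT y₀.1 (b ++ f' :: q') :=
        hy ▸ (OutListLT.of_edge hf _ _).append_left b
      refine hymax ⟨b ++ f' :: q', hw'⟩ ⟨Or.inr ?_,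
        ⟨x₀.1 ++ (M ++ (b ++ f' :: q')), x₀.2.append (hM.append hw')⟩, ?_, rfl⟩ hlt
      · rcases hy₀ with rfl | h
        · exact hlt
        · exact h.trans hlt
      · refine leftFree_splice hk hq (x := P ++ e :: c) (y := f :: Q) (x' := p' ++ e' :: c)
          (y' := f' :: q') (by simpa using hke') (by simpa using hqe)
          (InListLT.of_edge he _ _ _) (OutListLT.of_edge hf _ _) (Or.inr ?_)
        have h4 : M ++ (b ++ f' :: q') = a ++ e :: (c ++ f' :: q') := by
          rw [← List.append_assoc, ← hb]
          simp
        change x₀.1 ++ (M ++ (b ++ f' :: q')) = _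
        rw [h4, hP]
        simp
    -- Now `e` lies in `M`, and `M` has at most one edge. So `f` must be the first edge of `y₀`, and
    -- replacing it leaves `M` intact.
    · have hl := congrArg List.length hb
      simp only [List.length_append, List.length_cons] at hl
      have hb0 : b = [] := List.length_eq_zero_iff.1 (by omega)
      subst hb0
      simp only [List.nil_append] at hy
      have hw := y₀.2
      rw [← hy] at hw
      have hw' : G.IsWalk v (f' :: q') (Fin.last n) := ⟨hf.src_eq.symm.trans hw.1, hq2.2⟩
      have hlt : F.OutListLT y₀.1 (f' :: q') := hy ▸ OutListLT.of_edge hf _ _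
      refine hymax ⟨f' :: q', hw'⟩ ⟨Or.inr ?_,
        ⟨x₀.1 ++ (M ++ f' :: q'), x₀.2.append (hM.append hw')⟩, ?_, rfl⟩ hlt
      · rcases hy₀ with rfl | h
        · exact hlt
        · exact h.trans hlt
      · refine leftFree_splice hk hq (x := P ++ e :: c) (y := f :: Q) (x' := p' ++ e' :: c)
          (y' := f' :: q') (by simpa using hke') (by simpa using hqe)
          (InListLT.of_edge he _ _ _) (OutListLT.of_edge hf _ _) (Or.inr ?_)
        change x₀.1 ++ (M ++ f' :: q') = _
        rw [hP, hb]
        simp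
  rcases List.append_eq_append_iff.1 (hke.symm.trans hke') with ⟨a, hP, ha⟩ | ⟨a, hP, ha⟩
  · exact key2 a ha hP
  · cases a with
    | nil => exact key2 [] (by simpa using ha.symm) (by simpa using hP.symm)
    | cons g a =>
      simp only [List.cons_append, List.cons.injEq] at ha
      exact key1 a (by rw [hP, ha.1])

/-- With `M` empty, the route is moved clockwise at the very vertex where it is clockwise from `t`,
so the relation to `t` survives. -/
theorem exists_freeHull_routeCW (S : Set G.Route) (p : G.Route) (hp : p ∈ leftFree F.RouteCW S)
    (t : G.Route) (h : F.RouteCW p t) : ∃ k ∈ freeHull F.RouteCW S, F.RouteCW k t := by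
  obtain ⟨x, y, x', y', hpe, hte, hx, hy⟩ := ListCW.exists_split h
  obtain ⟨v, hv, hv'⟩ := (hpe ▸ p.2).split
  obtain ⟨k, hk, x₁, y₁, hke, h1, h2⟩ := exists_freeHull_through (M := []) (u := v) (v := v) rfl
    (by simp) ⟨x, hv⟩ ⟨y, hv'⟩ hp hpe
  refine ⟨k, hk, ?_⟩
  rw [RouteCW, hte, hke]
  refine ListCW.of_split ?_ ?_
  · rcases h1 with rfl | h1
    · exact hx
    · exact h1.trans hx
  · rcases h2 with rfl | h2
    · exact hy
    · exact hy.trans h2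

variable (F) in
theorem isInterpolative_routeCW : IsInterpolative F.RouteCW where
  irrefl P := ListCW.irrefl P.2
  exists_left := exists_freeHull_routeCW
  exists_right S p hp t h := by
    have := exists_freeHull_routeCW (F := F.dual) S p (by rw [routeCW_dual]; exact hp) t
      (by rw [routeCW_dual]; exact h)
    rw [routeCW_dual] at this
    exact this

end Finite

end Framing

end FlowGraph

/-! ### Routes of a maximal clique, and rotations -/

namespace FlowGraph

variable {n : ℕ} {E : Type*} {G : FlowGraph n E}

theorem Path.append_inj {v : Fin (n + 1)} {x x' : G.Path 0 v} {y y' : G.Path v (Fin.last n)}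
    (h : x.append y = x'.append y') : x = x' ∧ y = y' := by
  have := IsWalk.split_unique x.2 x'.2 (congrArg Subtype.val h)
  exact ⟨Subtype.ext this.1, Subtype.ext this.2⟩

namespace Framing

variable {F : G.Framing}

theorem RouteCW.of_append {v : Fin (n + 1)} {x x' : G.Path 0 v} {y y' : G.Path v (Fin.last n)}
    (h : F.InListLT x.1 x'.1) (h' : F.OutListLT y'.1 y.1) :
    F.RouteCW (x.append y) (x'.append y') := ListCW.of_split h h'

/-- A route decomposed as a list is decomposed as a path. -/
theorem exists_append_eq {v : Fin (n + 1)} {x : G.Path 0 v} {K : G.Route} {z₁ z₂ : List E}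
    (hK : K.1 = z₁ ++ z₂) (h : F.InListLT z₁ x.1 ∨ F.InListLT x.1 z₁) :
    ∃ (a : G.Path 0 v) (b : G.Path v (Fin.last n)), a.1 = z₁ ∧ b.1 = z₂ ∧ K = a.append b := by
  obtain ⟨w, hw, hw'⟩ := (hK ▸ K.2).split
  obtain rfl : w = v := by
    rcases h with h | h
    · exact h.end_eq hw x.2
    · exact (h.end_eq x.2 hw).symm
  exact ⟨⟨z₁, hw⟩, ⟨z₂, hw'⟩, rfl, rfl, Subtype.ext hK⟩

theorem ListCW.exists_append {P Q : G.Route} (h : F.ListCW P.1 Q.1) :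
    ∃ (v : Fin (n + 1)) (x x' : G.Path 0 v) (y y' : G.Path v (Fin.last n)),
      P = x.append y ∧ Q = x'.append y' ∧ F.InListLT x.1 x'.1 ∧ F.OutListLT y'.1 y.1 := by
  obtain ⟨v, x, y, x', y', hP, hQ, hx, hy⟩ := exists_cw_iff.2 h
  exact ⟨v, x, x', y, y', hP, hQ, hx, hy⟩

theorem ListCW.of_path_append_right {v : Fin (n + 1)} {K : G.Route} {x y : List E}
    {x₀ : G.Path 0 v} (hx : x <:+ x₀.1) (h : F.ListCW K.1 (x ++ y)) :
    (∃ (a : G.Path 0 v) (b : G.Path v (Fin.last n)), K = a.append b ∧ F.InListLT a.1 x ∧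
      F.OutListLT y b.1) ∨ F.ListCW K.1 x ∨ F.ListCW K.1 y := by
  rcases h.of_append_right with ⟨z₁, z₂, hz, h1, h2⟩ | h | h
  · obtain ⟨t, ht⟩ := hx
    obtain ⟨a, b, rfl, rfl, hK⟩ := exists_append_eq (F := F) (x := x₀) hz
      (Or.inl (ht ▸ h1.append_left [] t))
    exact Or.inl ⟨a, b, hK, h1, h2⟩
  · exact Or.inr (Or.inl h)
  · exact Or.inr (Or.inr h)

theorem ListCW.of_path_append_left {v : Fin (n + 1)} {K : G.Route} {x y : List E}
    {x₀ : G.Path 0 v} (hx : x <:+ x₀.1) (h : F.ListCW (x ++ y) K.1) :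
    (∃ (a : G.Path 0 v) (b : G.Path v (Fin.last n)), K = a.append b ∧ F.InListLT x a.1 ∧
      F.OutListLT b.1 y) ∨ F.ListCW x K.1 ∨ F.ListCW y K.1 := by
  simpa only [dual_listCW, dual_inListLT, dual_outListLT] using
    ListCW.of_path_append_right (F := F.dual) hx (dual_listCW.2 h)

theorem RouteCW.of_append_right {v : Fin (n + 1)} {K : G.Route} {x : G.Path 0 v}
    {y : G.Path v (Fin.last n)} (h : F.RouteCW K (x.append y)) :
    (∃ (a : G.Path 0 v) (b : G.Path v (Fin.last n)), K = a.append b ∧ F.InListLT a.1 x.1 ∧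
      F.OutListLT y.1 b.1) ∨ F.ListCW K.1 x.1 ∨ F.ListCW K.1 y.1 :=
  ListCW.of_path_append_right List.suffix_rfl h

theorem RouteCW.of_append_left {v : Fin (n + 1)} {K : G.Route} {x : G.Path 0 v}
    {y : G.Path v (Fin.last n)} (h : F.RouteCW (x.append y) K) :
    (∃ (a : G.Path 0 v) (b : G.Path v (Fin.last n)), K = a.append b ∧ F.InListLT x.1 a.1 ∧
      F.OutListLT b.1 y.1) ∨ F.ListCW x.1 K.1 ∨ F.ListCW y.1 K.1 :=
  ListCW.of_path_append_left List.suffix_rfl h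

theorem not_listCW_in {v : Fin (n + 1)} {K : G.Route} {x : G.Path 0 v}
    {y : G.Path v (Fin.last n)} (h : ¬ F.RouteCW K (x.append y)) : ¬ F.ListCW K.1 x.1 :=
  fun h' => h (h'.append_right _)

theorem not_listCW_out {v : Fin (n + 1)} {K : G.Route} {x : G.Path 0 v}
    {y : G.Path v (Fin.last n)} (h : ¬ F.RouteCW K (x.append y)) : ¬ F.ListCW K.1 y.1 :=
  fun h' => h (h'.append_left _)

theorem not_in_listCW {v : Fin (n + 1)} {K : G.Route} {x : G.Path 0 v}
    {y : G.Path v (Fin.last n)} (h : ¬ F.RouteCW (x.append y) K) : ¬ F.ListCW x.1 K.1 :=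
  fun h' => h (h'.right_append _)

theorem not_out_listCW {v : Fin (n + 1)} {K : G.Route} {x : G.Path 0 v}
    {y : G.Path v (Fin.last n)} (h : ¬ F.RouteCW (x.append y) K) : ¬ F.ListCW y.1 K.1 :=
  fun h' => h (h'.left_append _)

variable (F) in
/-- The routes `R` and `R'` are not coherent at `v`. -/
def IncoherentAt (v : Fin (n + 1)) (R R' : G.Route) : Prop :=
  ∃ (a a' : G.Path 0 v) (b b' : G.Path v (Fin.last n)), R = a.append b ∧ R' = a'.append b' ∧
    (F.InListLT a.1 a'.1 ∧ F.OutListLT b'.1 b.1 ∨ F.InListLT a'.1 a.1 ∧ F.OutListLT b.1 b'.1)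

theorem IncoherentAt.symm {v : Fin (n + 1)} {R R' : G.Route} (h : F.IncoherentAt v R R') :
    F.IncoherentAt v R' R := by
  obtain ⟨a, a', b, b', h1, h2, h3⟩ := h
  exact ⟨a', a, b', b, h2, h1, h3.symm⟩

/-- Incoherence with the second part of a route comes from incoherence at a later vertex. -/
theorem exists_incoherentAt_of_out {v : Fin (n + 1)} {R : G.Route} {x : G.Path 0 v}
    {y : G.Path v (Fin.last n)} (h : F.ListCW R.1 y.1 ∨ F.ListCW y.1 R.1) :
    ∃ w, v < w ∧ F.IncoherentAt w R (x.append y) := by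
  -- Stated for every framing, so that the second case is the first one for the dual framing.
  have key : ∀ {F : G.Framing}, F.ListCW R.1 y.1 →
      ∃ w, v < w ∧ F.IncoherentAt w R (x.append y) := by
    intro F h
    obtain ⟨z₁, z₂, y₁, y₂, hR, hy, h1, h2⟩ := h.exists_split
    obtain ⟨w, hw, hw'⟩ := (hy ▸ y.2).split
    obtain ⟨a, b, rfl, rfl, hab⟩ := exists_append_eq (F := F) (x := x.append ⟨y₁, hw⟩) hR
      (Or.inl (h1.append_left [] x.1))
    refine ⟨w, hw.lt ?_, a, x.append ⟨y₁, hw⟩, b, ⟨y₂, hw'⟩, hab, Subtype.ext ?_,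
      Or.inl ⟨h1.append_left [] x.1, h2⟩⟩
    · rintro rfl
      obtain ⟨p, q, c, e, f, -, hf, -⟩ := h1
      simp at hf
    · change x.1 ++ y.1 = (x.1 ++ y₁) ++ y₂
      rw [hy, List.append_assoc]
  rcases h with h | h
  · exact key h
  · obtain ⟨w, hvw, a, a', b, b', h1, h2, h3⟩ := key (dual_listCW.2 h)
    simp only [dual_inListLT, dual_outListLT] at h3
    exact ⟨w, hvw, a, a', b, b', h1, h2, h3.symm⟩

/-! ### Routes that a maximal clique must contain, and the effect of rotations -/

section Finite

variable [Finite E]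

/-- A concatenation lies in a maximal clique if its parts are coherent with the clique and the
coherence condition holds at the point of concatenation. -/
theorem append_mem_of_maximal {C : Set G.Route} (hC : Maximal (IsIndependent F.RouteCW) C)
    {v : Fin (n + 1)} {x : G.Path 0 v} {y : G.Path v (Fin.last n)}
    (hx : ∀ K ∈ C, ¬ F.ListCW K.1 x.1 ∧ ¬ F.ListCW x.1 K.1)
    (hy : ∀ K ∈ C, ¬ F.ListCW K.1 y.1 ∧ ¬ F.ListCW y.1 K.1)
    (hv : ∀ (a : G.Path 0 v) (b : G.Path v (Fin.last n)), a.append b ∈ C →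
      ¬ (F.InListLT a.1 x.1 ∧ F.OutListLT y.1 b.1) ∧
      ¬ (F.InListLT x.1 a.1 ∧ F.OutListLT b.1 y.1)) : x.append y ∈ C := by
  refine F.isInterpolative_routeCW.mem_of_maximal hC fun K hK => ⟨fun h => ?_, fun h => ?_⟩
  · rcases h.of_append_left with ⟨a, b, rfl, h'⟩ | h | h
    · exact (hv a b hK).2 h'
    · exact (hx K hK).2 h
    · exact (hy K hK).2 h
  · rcases h.of_append_right with ⟨a, b, rfl, h'⟩ | h | h
    · exact (hv a b hK).1 h'
    · exact (hx K hK).1 h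
    · exact (hy K hK).1 h

variable (F) in
theorem exists_min_out_walk (v : Fin (n + 1)) : ∃ m, G.IsWalk v m (Fin.last n) ∧
    ∀ p f q, m = p ++ f :: q → ∀ g, ¬ F.OutEdgeLT g f := by
  induction v using WellFoundedGT.induction with
  | ind v ih =>
    rcases eq_or_ne v (Fin.last n) with rfl | hv
    · exact ⟨[], rfl, by simp⟩
    · have : IsTrans E F.OutEdgeLT := ⟨OutEdgeLT.trans⟩
      have : Std.Irrefl F.OutEdgeLT := ⟨OutEdgeLT.irrefl⟩
      obtain ⟨f, rfl, hf⟩ := (Finite.wellFounded_of_trans_of_irrefl F.OutEdgeLT).has_min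
        {e | G.src e = v} (G.exists_out v hv)
      obtain ⟨m, hm, hm'⟩ := ih (G.tgt f) (G.src_lt_tgt f)
      refine ⟨f :: m, ⟨rfl, hm⟩, fun p g q hpq h hhg => ?_⟩
      cases p with
      | nil =>
        simp only [List.nil_append, List.cons.injEq] at hpq
        obtain ⟨rfl, -⟩ := hpq
        exact hf h hhg.src_eq hhg
      | cons a p =>
        simp only [List.cons_append, List.cons.injEq] at hpq
        exact hm' p g q hpq.2 h hhg

variable (F) in
theorem exists_max_in_walk (v : Fin (n + 1)) : ∃ l, G.IsWalk 0 l v ∧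
    ∀ p e q, l = p ++ e :: q → ∀ g, ¬ F.InEdgeLT e g := by
  induction v using WellFoundedLT.induction with
  | ind v ih =>
    rcases eq_or_ne v 0 with rfl | hv
    · exact ⟨[], rfl, by simp⟩
    · have : IsTrans E fun e f => F.InEdgeLT f e := ⟨fun _ _ _ h h' => InEdgeLT.trans _ _ _ h' h⟩
      have : Std.Irrefl fun e f => F.InEdgeLT f e := ⟨InEdgeLT.irrefl⟩
      obtain ⟨f, rfl, hf⟩ := (Finite.wellFounded_of_trans_of_irrefl
        fun e f => F.InEdgeLT f e).has_min {e | G.tgt e = v} (G.exists_in v hv)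
      obtain ⟨m, hm, hm'⟩ := ih (G.src f) (G.src_lt_tgt f)
      refine ⟨m ++ [f], hm.snoc, fun p g q hpq h hgh => ?_⟩
      rcases List.append_eq_append_iff.1 hpq with ⟨a, rfl, ha⟩ | ⟨a, rfl, ha⟩
      · cases a with
        | nil =>
          simp only [List.nil_append, List.cons.injEq] at ha
          obtain ⟨rfl, -⟩ := ha
          exact hf h hgh.tgt_eq.symm hgh
        | cons b a => simp at ha
      · cases a with
        | nil =>
          simp only [List.nil_append, List.cons.injEq] at ha
          obtain ⟨rfl, -⟩ := ha
          exact hf h hgh.tgt_eq.symm hgh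
        | cons b a =>
          simp only [List.cons_append, List.cons.injEq] at ha
          obtain ⟨rfl, -⟩ := ha
          exact hm' p g a rfl h hgh

variable (F) in
/-- Every path extends to a route without creating new clockwise relations. -/
theorem exists_route_extending {a b : Fin (n + 1)} {P : List E} (hP : G.IsWalk a P b) :
    ∃ (l : G.Path 0 a) (m : G.Path b (Fin.last n)) (r : G.Route), r.1 = l.1 ++ (P ++ m.1) ∧
      ∀ z, F.ListCW r.1 z → F.ListCW P z := by
  obtain ⟨l, hl, hl'⟩ := F.exists_max_in_walk a
  obtain ⟨m, hm, hm'⟩ := F.exists_min_out_walk b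
  refine ⟨⟨l, hl⟩, ⟨m, hm⟩, ⟨l ++ (P ++ m), hl.append (hP.append hm)⟩, rfl, ?_⟩
  -- The extension enters along maximal edges and leaves along minimal ones. Hence neither `e` nor
  -- `f` can lie outside `P`.
  rintro z ⟨p, c, q, p', q', e, f, e', f', hr, rfl, he, hf⟩
  have main : ∀ s, P ++ m = s ++ e :: (c ++ f :: q) →
      F.ListCW P (p' ++ e' :: (c ++ f' :: q')) := by
    intro s hs
    have hs' : P ++ m = (s ++ e :: c) ++ f :: q := by simpa using hs
    rcases List.append_eq_append_iff.1 hs' with ⟨t, -, ht⟩ | ⟨t, ht, ht'⟩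
    · exact absurd hf (hm' _ _ _ ht _)
    · cases t with
      | nil => exact absurd hf (hm' [] f q ht'.symm _)
      | cons g t =>
        simp only [List.cons_append, List.cons.injEq] at ht'
        obtain ⟨rfl, rfl⟩ := ht'
        exact ⟨s, c, t, p', q', e, f, e', f', by simp [ht], rfl, he, hf⟩
  change l ++ (P ++ m) = _ at hr
  rcases List.append_eq_append_iff.1 hr with ⟨s, -, hs⟩ | ⟨s, hs, hs'⟩
  · exact main s hs
  · cases s with
    | nil => exact main [] hs'.symm
    | cons g s =>
      simp only [List.cons_append, List.cons.injEq] at hs'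
      obtain ⟨rfl, -⟩ := hs'
      exact absurd he (hl' _ _ _ hs _)

/-- Every edge lies on a route of every maximal clique. -/
theorem exists_mem_through_edge {C : Set G.Route} (hC : Maximal (IsIndependent F.RouteCW) C)
    (e : E) : ∃ k ∈ C, ∃ (x : G.Path 0 (G.src e)) (y : G.Path (G.tgt e) (Fin.last n)),
      k.1 = x.1 ++ e :: y.1 := by
  have he : G.IsWalk (G.src e) [e] (G.tgt e) := ⟨rfl, rfl⟩
  obtain ⟨l, m, r, hr, hr'⟩ := F.exists_route_extending he
  -- A clockwise path needs an entering and a separate leaving edge, so a single edge is clockwise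
  -- from nothing.
  have hrC : r ∈ leftFree F.RouteCW C := by
    intro s _ hrs
    obtain ⟨p, c, q, p', q', f, g, f', g', h, -⟩ := hr' _ hrs
    have := congrArg List.length h
    simp at this
    omega
  obtain ⟨k, hk, x, y, hke, -⟩ := exists_freeHull_through he (by simp) l m hrC hr
  exact ⟨k, F.isInterpolative_routeCW.freeHull_eq hC ▸ hk, x, y, hke⟩

/-- If `C` has a route strictly below `x₂y₂` at `v`, then `C` has such a route which shares a part
with `x₂y₂`. -/
theorem exists_mem_step_down {C : Set G.Route} (hC : Maximal (IsIndependent F.RouteCW) C)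
    {v : Fin (n + 1)} {x₁ x₂ : G.Path 0 v} {y₁ y₂ : G.Path v (Fin.last n)}
    (h₁ : x₁.append y₁ ∈ C) (h₂ : x₂.append y₂ ∈ C) (hx : F.InListLT x₁.1 x₂.1)
    (hy : F.OutListLT y₁.1 y₂.1) :
    (∃ y : G.Path v (Fin.last n), x₂.append y ∈ C ∧ F.OutListLT y.1 y₂.1) ∨
      ∃ x : G.Path 0 v, x.append y₂ ∈ C ∧ F.InListLT x.1 x₂.1 := by
  by_contra! hcon
  -- With `z` as close to `x₂` as possible, a route of `C` incoherent with `z y₂` at `v` would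
  -- contradict the choice of `z`, the assumption `hcon`, or independence of `C`.
  obtain ⟨z, ⟨hz, z', hz', hzC⟩, hmax⟩ := (F.wellFounded_inListLT_swap 0 v).has_min
    {z | F.InListLT z.1 x₂.1 ∧ ∃ z' : G.Path v (Fin.last n), F.OutListLT z'.1 y₂.1 ∧
      z.append z' ∈ C} ⟨x₁, hx, y₁, hy, h₁⟩
  refine hcon.2 z (append_mem_of_maximal hC ?_ ?_ ?_) hz
  · exact fun K hK => ⟨not_listCW_in (hC.prop K hK _ hzC), not_in_listCW (hC.prop _ hzC K hK)⟩
  · exact fun K hK => ⟨not_listCW_out (hC.prop K hK _ h₂), not_out_listCW (hC.prop _ h₂ K hK)⟩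
  · intro a b hab
    refine ⟨fun h => ?_, fun h => ?_⟩
    · exact hC.prop _ hab _ h₂ (RouteCW.of_append (h.1.trans hz) h.2)
    · rcases F.inListLT_trichotomy a.2 x₂.2 with h3 | h3 | h3
      · exact hmax a ⟨h3, b, h.2, hab⟩ h.1
      · rw [Subtype.ext h3] at hab
        exact hcon.1 b hab h.2
      · exact hC.prop _ h₂ _ hab (RouteCW.of_append h3 h.2)

theorem exists_mem_step_up {C : Set G.Route} (hC : Maximal (IsIndependent F.RouteCW) C)
    {v : Fin (n + 1)} {x₁ x₂ : G.Path 0 v} {y₁ y₂ : G.Path v (Fin.last n)}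
    (h₁ : x₁.append y₁ ∈ C) (h₂ : x₂.append y₂ ∈ C) (hx : F.InListLT x₁.1 x₂.1)
    (hy : F.OutListLT y₁.1 y₂.1) :
    (∃ y : G.Path v (Fin.last n), x₁.append y ∈ C ∧ F.OutListLT y₁.1 y.1) ∨
      ∃ x : G.Path 0 v, x.append y₁ ∈ C ∧ F.InListLT x₁.1 x.1 := by
  have hC' : Maximal (IsIndependent F.dual.RouteCW) C := by
    rw [routeCW_dual]
    exact maximal_isIndependent_flip.2 hC
  simpa only [dual_inListLT, dual_outListLT] using
    exists_mem_step_down hC' h₂ h₁ (dual_inListLT.2 hx) (dual_outListLT.2 hy)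

/-- Since `v` is the last vertex of incoherence, `y` and `y'` are coherent with the opposite routes.
This puts `x y'` into `C`, hence into `D`, and `x' y` into `D`. A route clockwise from `R = x y` is
clockwise from one of these two, so freeness for `D` implies freeness for `C`. -/
theorem leftFree_subset_of_last_incoherent {C D : Set G.Route}
    (hC : Maximal (IsIndependent F.RouteCW) C) (hD : Maximal (IsIndependent F.RouteCW) D)
    {R R' : G.Route} (hR : R ∈ C) (hR' : R' ∈ D) (hCD : ∀ T ∈ C, T ≠ R → T ∈ D)
    (hDC : ∀ T ∈ D, T ≠ R' → T ∈ C) {v : Fin (n + 1)}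
    (hlast : ∀ w, v < w → ¬ F.IncoherentAt w R R') {x x' : G.Path 0 v}
    {y y' : G.Path v (Fin.last n)} (hRe : R = x.append y) (hRe' : R' = x'.append y')
    (hx : F.InListLT x.1 x'.1) (hy : F.OutListLT y'.1 y.1) :
    leftFree F.RouteCW D ⊆ leftFree F.RouteCW C := by
  have hyR : ¬ F.ListCW R.1 y'.1 ∧ ¬ F.ListCW y'.1 R.1 := by
    by_contra hcon
    obtain ⟨w, hw, hw'⟩ := exists_incoherentAt_of_out (F := F) (x := x') 
      (not_and_or.1 hcon |>.imp not_not.1 not_not.1)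
    exact hlast w hw (hRe' ▸ hw')
  have hyR' : ¬ F.ListCW R'.1 y.1 ∧ ¬ F.ListCW y.1 R'.1 := by
    by_contra hcon
    obtain ⟨w, hw, hw'⟩ := exists_incoherentAt_of_out (F := F) (x := x) 
      (not_and_or.1 hcon |>.imp not_not.1 not_not.1)
    exact hlast w hw (hRe ▸ hw').symm
  have hne : y ≠ y' := by
    rintro rfl
    exact OutListLT.irrefl _ hy
  have hRC : x.append y ∈ C := hRe ▸ hR
  have hRD : x'.append y' ∈ D := hRe' ▸ hR'
  have hQC : x.append y' ∈ C := by
    refine append_mem_of_maximal hC ?_ ?_ ?_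
    · exact fun K hK => ⟨not_listCW_in (hC.prop K hK _ hRC), not_in_listCW (hC.prop _ hRC K hK)⟩
    · intro K hK
      by_cases hKR : K = R
      · exact hKR ▸ hyR
      · have hKD := hCD K hK hKR
        exact ⟨not_listCW_out (hD.prop K hKD _ hRD), not_out_listCW (hD.prop _ hRD K hKD)⟩
    · intro a b hab
      refine ⟨fun h => ?_, fun h => ?_⟩
      · by_cases hKR : a.append b = R
        · rw [hRe] at hKR
          rw [(Path.append_inj hKR).1] at h
          exact InListLT.irrefl _ h.1
        · exact hD.prop _ (hCD _ hab hKR) _ hRD (RouteCW.of_append (h.1.trans hx) h.2)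
      · exact hC.prop _ hRC _ hab (RouteCW.of_append h.1 (h.2.trans hy))
  have hQD : x'.append y ∈ D := by
    refine append_mem_of_maximal hD ?_ ?_ ?_
    · exact fun K hK => ⟨not_listCW_in (hD.prop K hK _ hRD), not_in_listCW (hD.prop _ hRD K hK)⟩
    · intro K hK
      by_cases hKR : K = R'
      · exact hKR ▸ hyR'
      · have hKC := hDC K hK hKR
        exact ⟨not_listCW_out (hC.prop K hKC _ hRC), not_out_listCW (hC.prop _ hRC K hKC)⟩
    · intro a b hab
      refine ⟨fun h => ?_, fun h => ?_⟩
      · exact hD.prop _ hab _ hRD (RouteCW.of_append h.1 (hy.trans h.2))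
      · by_cases hKR : a.append b = R'
        · rw [hRe'] at hKR
          rw [(Path.append_inj hKR).1] at h
          exact InListLT.irrefl _ h.1
        · exact hC.prop _ hRC _ (hDC _ hab hKR) (RouteCW.of_append (hx.trans h.1) h.2)
  have hQ : x.append y' ∈ D := hCD _ hQC fun h => hne (Path.append_inj (h.trans hRe)).2.symm
  intro P hP K hK hPK
  by_cases hKR : K = R
  · rw [hKR, hRe] at hPK
    rcases hPK.of_append_right with ⟨a, b, rfl, h1, h2⟩ | h | h
    · exact hP _ hQD (RouteCW.of_append (h1.trans hx) h2)
    · exact not_listCW_in (hP _ hQ) h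
    · exact not_listCW_out (hP _ hQD) h
  · exact hP K (hCD K hK hKR) hPK

/-- Rotations increase maximal cliques. -/
theorem leftFree_subset_of_rotation {C D : Set G.Route}
    (hC : Maximal (IsIndependent F.RouteCW) C) (hD : Maximal (IsIndependent F.RouteCW) D)
    {R R' : G.Route} (hR : R ∈ C) (hDe : D = (C \ {R}) ∪ {R'}) (h : F.RouteCW R R') :
    leftFree F.RouteCW D ⊆ leftFree F.RouteCW C := by
  have hR' : R' ∈ D := hDe ▸ Or.inr rfl
  have hCD : ∀ T ∈ C, T ≠ R → T ∈ D := fun T hT hTR => hDe ▸ Or.inl ⟨hT, hTR⟩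
  have hDC : ∀ T ∈ D, T ≠ R' → T ∈ C := by
    intro T hT hTR
    rw [hDe] at hT
    exact hT.elim (fun h => h.1) fun h => absurd h hTR
  obtain ⟨v₀, a, a', b, b', h1, h2, h3, h4⟩ := ListCW.exists_append h
  obtain ⟨v, ⟨x, x', y, y', hRe, hRe', hxy⟩, hv⟩ :=
    (wellFounded_gt (α := Fin (n + 1))).has_min {v | F.IncoherentAt v R R'}
      ⟨v₀, a, a', b, b', h1, h2, Or.inl ⟨h3, h4⟩⟩
  rcases hxy with hxy | hxy
  · exact leftFree_subset_of_last_incoherent hC hD hR hR' hCD hDC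
      (fun w hw hi => hv w hi hw) hRe hRe' hxy.1 hxy.2
  -- In the opposite orientation the roles of `C` and `D` are exchanged; then `R`, being free for
  -- `C`, would be free for `D`, against `h`.
  · have := leftFree_subset_of_last_incoherent hD hC hR' hR hDC hCD
      (fun w hw hi => hv w hi.symm hw) hRe' hRe hxy.1 hxy.2
    exact absurd h (this (hC.prop R hR) R' hR')

end Finite

end Framing

end FlowGraph

/-! ### Corners of a maximal clique -/

namespace FlowGraph

variable {n : ℕ} {E : Type*} {G : FlowGraph n E}

theorem Path.append_assoc {t u v w : Fin (n + 1)} (x : G.Path t u) (y : G.Path u v)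
    (z : G.Path v w) : (x.append y).append z = x.append (y.append z) :=
  Subtype.ext (List.append_assoc _ _ _)

namespace Framing

variable {F : G.Framing}

theorem not_inListLT_nil {x : List E} : ¬ F.InListLT x [] := by
  rintro ⟨p, q, c, e, f, -, h, -⟩
  simp at h

/-- The relation cannot straddle `v`, because `x` ends there and has no leaving edge. -/
theorem ListCW.left_of_in {v : Fin (n + 1)} {a x : G.Path 0 v} {d : G.Path v (Fin.last n)}
    (h : F.ListCW (a.append d).1 x.1) : F.ListCW a.1 x.1 ∨ F.ListCW d.1 x.1 := by
  rcases ListCW.of_append_left h with ⟨z₁, z₂, hz, h1, h2⟩ | h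
  · obtain ⟨w, hw, hw'⟩ := (hz ▸ x.2).split
    cases h1.end_eq a.2 hw
    rw [hw'.eq_nil] at h2
    exact absurd h2 PrefixLex.not_nil_left
  · exact h

theorem ListCW.left_of_out {v : Fin (n + 1)} {a : G.Path 0 v} {d y : G.Path v (Fin.last n)}
    (h : F.ListCW (a.append d).1 y.1) : F.ListCW a.1 y.1 ∨ F.ListCW d.1 y.1 := by
  rcases ListCW.of_append_left h with ⟨z₁, z₂, hz, h1, h2⟩ | h
  · obtain ⟨w, hw, hw'⟩ := (hz ▸ y.2).split
    cases h1.end_eq a.2 hw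
    rw [hw.eq_nil] at h1
    exact absurd h1 not_inListLT_nil
  · exact h

theorem ListCW.right_of_in {v : Fin (n + 1)} {a x : G.Path 0 v} {d : G.Path v (Fin.last n)}
    (h : F.ListCW x.1 (a.append d).1) : F.ListCW x.1 a.1 ∨ F.ListCW x.1 d.1 := by
  simpa only [dual_listCW] using ListCW.left_of_in (dual_listCW.2 h)

theorem ListCW.right_of_out {v : Fin (n + 1)} {a : G.Path 0 v} {d y : G.Path v (Fin.last n)}
    (h : F.ListCW y.1 (a.append d).1) : F.ListCW y.1 a.1 ∨ F.ListCW y.1 d.1 := by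
  simpa only [dual_listCW] using ListCW.left_of_out (dual_listCW.2 h)

variable (F) in
/-- At the vertex `w`, the routes of `C` make a corner: `ab`, `ad` and `a'd` are consecutive. -/
structure IsCorner (C : Set G.Route) {w : Fin (n + 1)} (a a' : G.Path 0 w)
    (b d : G.Path w (Fin.last n)) : Prop where
  mem_down : a.append b ∈ C
  mem : a.append d ∈ C
  mem_right : a'.append d ∈ C
  in_lt : F.InListLT a.1 a'.1
  out_lt : F.OutListLT b.1 d.1
  no_in : ∀ z : G.Path 0 w, F.InListLT a.1 z.1 → F.InListLT z.1 a'.1 → z.append d ∉ C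
  no_out : ∀ z : G.Path w (Fin.last n), F.OutListLT b.1 z.1 → F.OutListLT z.1 d.1 →
    a.append z ∉ C

namespace IsCorner

variable {C : Set G.Route} {w : Fin (n + 1)} {a a' : G.Path 0 w} {b d : G.Path w (Fin.last n)}

theorem down_ne (h : F.IsCorner C a a' b d) : a.append b ≠ a.append d := by
  intro hab
  have := h.out_lt
  rw [(Path.append_inj hab).2] at this
  exact OutListLT.irrefl _ this

theorem right_ne (h : F.IsCorner C a a' b d) : a'.append d ≠ a.append d := by
  intro hab
  have := h.in_lt
  rw [(Path.append_inj hab).1] at this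
  exact InListLT.irrefl _ this

theorem routeCW (h : F.IsCorner C a a' b d) : F.RouteCW (a.append d) (a'.append b) :=
  RouteCW.of_append h.in_lt h.out_lt

/-- No edge lies between the edges at which `a` and `a'` differ. -/
theorem not_between_in [Finite E] (h : F.IsCorner C a a' b d)
    (hC : Maximal (IsIndependent F.RouteCW) C) {A A' c : List E} {e e' g : E}
    (ha : a.1 = A ++ e :: c) (ha' : a'.1 = A' ++ e' :: c) (heg : F.InEdgeLT e g)
    (hge : F.InEdgeLT g e') : False := by
  obtain ⟨k, hk, x, y, hke⟩ := exists_mem_through_edge hC g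
  have hwa := a.2
  rw [ha] at hwa
  have hwa' := a'.2
  rw [ha'] at hwa'
  have h1 := hwa.split_cons
  have h2 := hwa'.split_cons
  have hc : G.IsWalk (G.tgt g) c w := heg.tgt_eq ▸ h1.2
  have hcd : G.IsWalk (G.tgt g) (c ++ d.1) (Fin.last n) := hc.append d.2
  have hN := h.mem
  have hB := h.mem_right
  have hNe : (a.append d).1 = (A ++ [e]) ++ (c ++ d.1) := by
    change a.1 ++ d.1 = _
    simp [ha]
  have hBe : (a'.append d).1 = (A' ++ [e']) ++ (c ++ d.1) := by
    change a'.1 ++ d.1 = _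
    simp [ha']
  have hke' : k.1 = (x.1 ++ [g]) ++ y.1 := by simp [hke]
  -- After `g`, the route `k` is squeezed between `a d` and `a' d`: any deviation from `c ++ d`
  -- makes it incoherent with one of them.
  have hyeq : y.1 = c ++ d.1 := by
    rcases F.outListLT_trichotomy y.2 hcd with h3 | h3 | h3
    · refine absurd ?_ (hC.prop _ hN _ hk)
      rw [RouteCW, hNe, hke']
      exact ListCW.of_split (InListLT.of_edge heg _ _ _) h3
    · exact h3
    · refine absurd ?_ (hC.prop _ hk _ hB)
      rw [RouteCW, hBe, hke']
      exact ListCW.of_split (InListLT.of_edge hge _ _ _) h3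
  have hz : G.IsWalk 0 (x.1 ++ g :: c) w := x.2.append ⟨rfl, hc⟩
  refine h.no_in ⟨x.1 ++ g :: c, hz⟩ ?_ ?_ ?_
  · exact ha ▸ InListLT.of_edge heg _ _ _
  · exact ha' ▸ InListLT.of_edge hge _ _ _
  · convert hk
    refine Subtype.ext ?_
    change (x.1 ++ g :: c) ++ d.1 = k.1
    rw [hke, hyeq]
    simp

/-- No edge lies between the edges at which `b` and `d` differ. -/
theorem not_between_out [Finite E] (h : F.IsCorner C a a' b d)
    (hC : Maximal (IsIndependent F.RouteCW) C) {B D c : List E} {f f' g : E}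
    (hb : b.1 = c ++ f :: B) (hd : d.1 = c ++ f' :: D) (hfg : F.OutEdgeLT f g)
    (hgf : F.OutEdgeLT g f') : False := by
  obtain ⟨k, hk, x, y, hke⟩ := exists_mem_through_edge hC g
  have hwb := b.2
  rw [hb] at hwb
  have h1 := hwb.split_cons
  have hc : G.IsWalk w c (G.src g) := hfg.src_eq ▸ h1.1
  have hac : G.IsWalk 0 (a.1 ++ c) (G.src g) := a.2.append hc
  have hN := h.mem
  have hS := h.mem_down
  have hNe : (a.append d).1 = (a.1 ++ c) ++ f' :: D := by
    change a.1 ++ d.1 = _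
    simp [hd]
  have hSe : (a.append b).1 = (a.1 ++ c) ++ f :: B := by
    change a.1 ++ b.1 = _
    simp [hb]
  -- Before `g`, the route `k` is squeezed between `a b` and `a d` in the same way.
  have hxeq : x.1 = a.1 ++ c := by
    rcases F.inListLT_trichotomy x.2 hac with h3 | h3 | h3
    · refine absurd ?_ (hC.prop _ hk _ hS)
      rw [RouteCW, hSe, hke]
      exact ListCW.of_split h3 (OutListLT.of_edge hfg _ _)
    · exact h3
    · refine absurd ?_ (hC.prop _ hN _ hk)
      rw [RouteCW, hNe, hke]
      exact ListCW.of_split h3 (OutListLT.of_edge hgf _ _)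
  have hz : G.IsWalk w (c ++ g :: y.1) (Fin.last n) := hc.append ⟨rfl, y.2⟩
  refine h.no_out ⟨c ++ g :: y.1, hz⟩ ?_ ?_ ?_
  · exact hb ▸ (OutListLT.of_edge hfg _ _).append_left c
  · exact hd ▸ (OutListLT.of_edge hgf _ _).append_left c
  · convert hk
    refine Subtype.ext ?_
    change a.1 ++ (c ++ g :: y.1) = k.1
    rw [hke, hxeq]
    simp

/-- Only the opposite corner can replace `ad` in `C`. -/
theorem eq_of_coherent [Finite E] (h : F.IsCorner C a a' b d)
    (hC : Maximal (IsIndependent F.RouteCW) C) {T : G.Route} (hT : T ∉ C)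
    (hcoh : ∀ K ∈ C, K ≠ a.append d → ¬ F.RouteCW K T ∧ ¬ F.RouteCW T K) :
    T = a'.append b := by
  have hS := hcoh _ h.mem_down h.down_ne
  have hB := hcoh _ h.mem_right h.right_ne
  have hN : F.RouteCW T (a.append d) ∨ F.RouteCW (a.append d) T := by
    by_contra! hcon
    refine hT (F.isInterpolative_routeCW.mem_of_maximal hC fun K hK => ?_)
    by_cases hKN : K = a.append d
    · exact hKN ▸ hcon
    · exact (hcoh K hK hKN).symm
  rcases hN with hN | hN
  · rcases hN.of_append_right with ⟨t₁, t₂, rfl, h1, h2⟩ | h1 | h1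
    · exact absurd (RouteCW.of_append (h1.trans h.in_lt) h2) hB.2
    · exact absurd h1 (not_listCW_in hS.2)
    · exact absurd h1 (not_listCW_out hB.2)
  rcases hN.of_append_left with ⟨t₁, t₂, rfl, h1, h2⟩ | h1 | h1
  rotate_left
  · exact absurd h1 (not_in_listCW hS.1)
  · exact absurd h1 (not_out_listCW hB.1)
  have ht₁ : ¬ F.InListLT a'.1 t₁.1 := fun h3 => hB.1 (RouteCW.of_append h3 h2)
  have ht₂ : ¬ F.OutListLT t₂.1 b.1 := fun h3 => hS.1 (RouteCW.of_append h1 h3)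
  have hpart : ∀ K ∈ C, (¬ F.ListCW K.1 t₁.1 ∧ ¬ F.ListCW t₁.1 K.1) ∧
      (¬ F.ListCW K.1 t₂.1 ∧ ¬ F.ListCW t₂.1 K.1) := by
    intro K hK
    by_cases hKN : K = a.append d
    · subst hKN
      -- The removed route `a d` also causes no trouble for the parts of `T`: `a` lies on `a b` and
      -- `d` lies on `a' d`, and both routes are coherent with `T`.
      refine ⟨⟨fun h3 => ?_, fun h3 => ?_⟩, fun h3 => ?_, fun h3 => ?_⟩
      · rcases h3.left_of_in with h3 | h3
        · exact not_in_listCW hS.1 (h3.append_right _)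
        · exact not_out_listCW hB.1 (h3.append_right _)
      · rcases h3.right_of_in with h3 | h3
        · exact not_listCW_in hS.2 (h3.right_append _)
        · exact not_listCW_out hB.2 (h3.right_append _)
      · rcases h3.left_of_out with h3 | h3
        · exact not_in_listCW hS.1 (h3.append_left _)
        · exact not_out_listCW hB.1 (h3.append_left _)
      · rcases h3.right_of_out with h3 | h3
        · exact not_listCW_in hS.2 (h3.left_append _)
        · exact not_listCW_out hB.2 (h3.left_append _)
    · have := hcoh K hK hKN
      exact ⟨⟨not_listCW_in this.1, not_in_listCW this.2⟩,
        not_listCW_out this.1, not_out_listCW this.2⟩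
  have hNC := h.mem
  -- Mixing parts of `T` and `a d` gives routes of `C` within the corner; consecutiveness then
  -- forces `t₁ = a'` and `t₂ = b`.
  have h3 : t₁.append d ∈ C := by
    refine append_mem_of_maximal hC (fun K hK => (hpart K hK).1) ?_ ?_
    · exact fun K hK => ⟨not_listCW_out (hC.prop K hK _ hNC), not_out_listCW (hC.prop _ hNC K hK)⟩
    · intro k₁ k₂ hk
      refine ⟨fun h3 => ?_, fun h3 => ?_⟩
      · refine hC.prop _ hk _ h.mem_right (RouteCW.of_append ?_ h3.2)
        rcases F.inListLT_trichotomy t₁.2 a'.2 with h4 | h4 | h4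
        · exact h3.1.trans h4
        · exact h4 ▸ h3.1
        · exact absurd h4 ht₁
      · exact hC.prop _ hNC _ hk (RouteCW.of_append (h1.trans h3.1) h3.2)
  have h4 : a.append t₂ ∈ C := by
    refine append_mem_of_maximal hC ?_ (fun K hK => (hpart K hK).2) ?_
    · exact fun K hK => ⟨not_listCW_in (hC.prop K hK _ hNC), not_in_listCW (hC.prop _ hNC K hK)⟩
    · intro k₁ k₂ hk
      refine ⟨fun h3 => ?_, fun h3 => ?_⟩
      · refine hC.prop _ hk _ h.mem_down (RouteCW.of_append h3.1 ?_)
        rcases F.outListLT_trichotomy b.2 t₂.2 with h4 | h4 | h4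
        · exact h4.trans h3.2
        · exact h4 ▸ h3.2
        · exact absurd h4 ht₂
      · exact hC.prop _ hNC _ hk (RouteCW.of_append h3.1 (h3.2.trans h2))
  have h5 : t₁ = a' := by
    rcases F.inListLT_trichotomy t₁.2 a'.2 with h5 | h5 | h5
    · exact absurd h3 (h.no_in t₁ h1 h5)
    · exact Subtype.ext h5
    · exact absurd h5 ht₁
  have h6 : t₂ = b := by
    rcases F.outListLT_trichotomy b.2 t₂.2 with h6 | h6 | h6
    · exact absurd h4 (h.no_out t₂ h6 h2)
    · exact (Subtype.ext h6).symm
    · exact absurd h6 ht₂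
  rw [h5, h6]

/-- A route clockwise from the common part of the flipped corner, but coherent with the other two
routes of the corner, follows `ad` along this common part. -/
theorem exists_of_listCW [Finite E] (h : F.IsCorner C a a' b d)
    (hC : Maximal (IsIndependent F.RouteCW) C) {A A' c B D c' : List E} {e e' f f' : E}
    (ha : a.1 = A ++ e :: c) (ha' : a'.1 = A' ++ e' :: c)
    (hb : b.1 = c' ++ f :: B) (hd : d.1 = c' ++ f' :: D)
    {T : G.Route} (hTS : ¬ F.RouteCW T (a.append b)) (hTB : ¬ F.RouteCW T (a'.append d))
    (hT : F.ListCW T.1 (e' :: c ++ (c' ++ [f]))) :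
    ∃ (t : G.Path 0 w) (s : G.Path w (Fin.last n)) (r q : List E), T = t.append s ∧
      F.InListLT t.1 a'.1 ∧ F.OutListLT b.1 s.1 ∧ ¬ F.InListLT t.1 a.1 ∧
      ¬ F.OutListLT d.1 s.1 ∧ t.1 = r ++ e :: c ∧ s.1 = c' ++ f' :: q := by
  -- The path is a final part of `a'` followed by an initial part of `b`. A relation inside one of
  -- these would make `T` clockwise from `a' d` or `a b`, so it occurs at `w`.
  rcases ListCW.of_path_append_right (x₀ := a') ⟨A', ha'.symm⟩ hT with
    ⟨t, s, rfl, h1, h2⟩ | h1 | h1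
  rotate_left
  · exact absurd (ha' ▸ h1.append_left A') (not_listCW_in hTB)
  · have h2 := h1.append_right B
    simp only [List.append_assoc, List.cons_append, List.nil_append] at h2
    exact absurd (hb ▸ h2) (not_listCW_out hTS)
  have hta' : F.InListLT t.1 a'.1 := ha' ▸ h1.append_left [] A'
  have hsb : F.OutListLT b.1 s.1 := by
    simpa [hb] using h2.append_right B []
  have hta : ¬ F.InListLT t.1 a.1 := fun h3 => hTS (RouteCW.of_append h3 hsb)
  have hsd : ¬ F.OutListLT d.1 s.1 := fun h3 => hTB (RouteCW.of_append hta' h3)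
  have hwa := a.2
  rw [ha] at hwa
  have hwa' := a'.2
  rw [ha'] at hwa'
  have hwb := b.2
  rw [hb] at hwb
  have hwd := d.2
  rw [hd] at hwd
  -- If `t` departed from `c` inside `c`, it would lie below `a`. So it differs at `e'`, and there
  -- only `e` remains because no edge lies between `e` and `e'`.
  have hin : ∃ r, t.1 = r ++ e :: c := by
    obtain ⟨r, r', c₂, g, g', ht, hc₂, hg⟩ := h1
    cases r' with
    | nil =>
      simp only [List.nil_append, List.cons.injEq] at hc₂
      obtain ⟨rfl, rfl⟩ := hc₂
      have hwt := t.2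
      rw [ht] at hwt
      have htgt : G.tgt e = G.tgt g := by
        rw [hg.tgt_eq]
        exact hwa.split_cons.2.start_unique hwa'.split_cons.2
      rcases F.inEdgeLT_trichotomy htgt with h3 | rfl | h3
      · exact (h.not_between_in hC ha ha' h3 hg).elim
      · exact ⟨r, ht⟩
      · refine absurd ?_ hta
        rw [ht, ha]
        exact InListLT.of_edge h3 _ _ _
    | cons x r' =>
      simp only [List.cons_append, List.cons.injEq] at hc₂
      obtain ⟨rfl, rfl⟩ := hc₂
      refine absurd ?_ hta
      rw [ht, ha]
      exact ⟨r, A ++ e :: r', c₂, g, g', rfl, by simp, hg⟩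
  have hout : ∃ q, s.1 = c' ++ f' :: q := by
    obtain ⟨c₂, q', q, g', g, hc₂, hs, hg⟩ := h2
    have key : c' = c₂ → f = g' → ∃ q, s.1 = c' ++ f' :: q := by
      rintro rfl rfl
      have hws := s.2
      rw [hs] at hws
      have hsrc : G.src g = G.src f' := hws.split_cons.1.end_unique hwd.split_cons.1
      rcases F.outEdgeLT_trichotomy hsrc with h3 | rfl | h3
      · exact (h.not_between_out hC hb hd hg h3).elim
      · exact ⟨q, hs⟩
      · refine absurd ?_ hsd
        rw [hs, hd]
        exact (OutListLT.of_edge h3 _ _).append_left _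
    rcases List.append_eq_append_iff.1 hc₂ with ⟨z, hz, hz'⟩ | ⟨z, hz, hz'⟩
    · cases z with
      | nil =>
        simp only [List.nil_append, List.cons.injEq] at hz'
        exact key (by simpa using hz.symm) hz'.1
      | cons x z => simp at hz'
    · cases z with
      | nil =>
        simp only [List.nil_append, List.cons.injEq] at hz'
        exact key (by simpa using hz) hz'.1.symm
      | cons x z =>
        simp only [List.cons_append, List.cons.injEq] at hz'
        obtain ⟨rfl, -⟩ := hz'
        refine absurd ?_ hsd
        rw [hs, hd, hz]
        exact ⟨c₂, z ++ f' :: D, q, g', g, by simp, rfl, hg⟩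
  obtain ⟨r, hr⟩ := hin
  obtain ⟨q, hq⟩ := hout
  exact ⟨t, s, r, q, rfl, hta', hsb, hta, hsd, hr, hq⟩

end IsCorner

end Framing

end FlowGraph

/-! ### Existence of rotations -/

namespace FlowGraph

variable {n : ℕ} {E : Type*} {G : FlowGraph n E}

namespace Framing

variable {F : G.Framing} [Finite E]

/-- If all routes of `C` clockwise from the path `e' c f'` contain `c`, then `C` has a corner on
such a route. -/
theorem exists_isCorner {C : Set G.Route} (hC : Maximal (IsIndependent F.RouteCW) C)
    {e' f' : E} (c : G.Path (G.tgt e') (G.src f'))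
    (hmin : ∀ N ∈ C, F.ListCW N.1 (e' :: (c.1 ++ [f'])) → ∃ p q e f,
      N.1 = p ++ e :: (c.1 ++ f :: q) ∧ F.InEdgeLT e e' ∧ F.OutEdgeLT f' f)
    (hex : ∃ N ∈ C, F.ListCW N.1 (e' :: (c.1 ++ [f']))) :
    ∃ (a a' : G.Path 0 (G.src f')) (b d : G.Path (G.src f') (Fin.last n)),
      F.IsCorner C a a' b d ∧ (∃ p e, a.1 = p ++ e :: c.1 ∧ F.InEdgeLT e e') ∧
      (∃ f q, d.1 = f :: q ∧ F.OutEdgeLT f' f) ∧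
      ∃ x : List E, a'.1 = x ++ c.1 ∨ F.InListLT a'.1 (x ++ c.1) := by
  have hdec : ∀ (x : G.Path 0 (G.tgt e')) (y : G.Path (G.tgt e') (Fin.last n)),
      x.append y ∈ C → F.InListLT x.1 [e'] → F.OutListLT (c.1 ++ [f']) y.1 →
      ∃ p q e f, x.1 = p ++ [e] ∧ y.1 = c.1 ++ f :: q ∧ F.InEdgeLT e e' ∧ F.OutEdgeLT f' f := by
    intro x y hxy hx hy
    obtain ⟨p, q, e, f, hN, he, hf⟩ := hmin _ hxy (ListCW.of_split (x' := [e']) hx hy)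
    have hw := (x.append y).2
    rw [hN] at hw
    have hw' : G.IsWalk 0 (p ++ [e]) (G.tgt e') := he.tgt_eq ▸ hw.split_cons.1.snoc
    have := IsWalk.split_unique (y := y.1) (y' := c.1 ++ f :: q) x.2 hw' (hN.trans (by simp))
    exact ⟨p, q, e, f, this.1, this.2, he, hf⟩
  -- choice of a corner route: `y` is maximal and then `x` is minimal
  obtain ⟨y, ⟨⟨x₁, hx₁C, hx₁⟩, hy⟩, hymax⟩ :=
    (F.wellFounded_outListLT_swap (G.tgt e') (Fin.last n)).has_min
      {y | (∃ x : G.Path 0 (G.tgt e'), x.append y ∈ C ∧ F.InListLT x.1 [e']) ∧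
        F.OutListLT (c.1 ++ [f']) y.1} (by
      obtain ⟨N, hN, hNcw⟩ := hex
      obtain ⟨p, q, e, f, hNe, he, hf⟩ := hmin N hN hNcw
      -- The auxiliary path only serves to fix the splitting vertex; any path from the source that
      -- ends with `e'` would do.
      obtain ⟨x, y, hx, hy, rfl⟩ := exists_append_eq (F := F) (x := ⟨_, (F.exists_max_in_walk
          (G.src e')).choose_spec.1.snoc⟩) (z₁ := p ++ [e]) (z₂ := c.1 ++ f :: q)
          (hNe.trans (by simp)) (Or.inl (InListLT.of_edge he _ _ _))
      refine ⟨y, ⟨x, hN, hx ▸ InListLT.of_edge he p [] []⟩, hy ▸ ?_⟩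
      exact (OutListLT.of_edge hf _ _).append_left _)
  obtain ⟨x, ⟨hxC, hx⟩, hxmin⟩ := (F.wellFounded_inListLT 0 (G.tgt e')).has_min
    {x | x.append y ∈ C ∧ F.InListLT x.1 [e']} ⟨x₁, hx₁C, hx₁⟩
  obtain ⟨p, q, e, f, hxe, hye, he, hf⟩ := hdec x y hxC hx hy
  -- a route to the right of the chosen one
  have hright : ∃ x' : G.Path 0 (G.tgt e'), x'.append y ∈ C ∧ F.InListLT x.1 x'.1 := by
    obtain ⟨k, hk, l, m, hke⟩ := exists_mem_through_edge hC e'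
    have hkeq : k = Path.append ⟨l.1 ++ [e'], l.2.snoc⟩ m :=
      Subtype.ext (hke.trans (by simp [Path.append]))
    rw [hkeq] at hk
    have hlt : F.InListLT x.1 (l.1 ++ [e']) := hx.append_left [] l.1
    -- When the route through `e'` continues above `y`, stepping up from `x y` must change the
    -- initial part, since `y` is maximal.
    rcases F.outListLT_trichotomy y.2 m.2 with h | h | h
    · rcases exists_mem_step_up hC hxC hk hlt h with ⟨y', hy'C, hy'⟩ | h'
      · exact absurd hy' (hymax y' ⟨⟨x, hy'C, hx⟩, hy.trans hy'⟩)
      · exact h'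
    · exact ⟨_, Subtype.ext h ▸ hk, hlt⟩
    · exact absurd (RouteCW.of_append hlt h) (hC.prop _ hxC _ hk)
  obtain ⟨x', hx'C, hxx'⟩ := hright
  have hyw := y.2
  rw [hye] at hyw
  have hd : G.IsWalk (G.src f') (f :: q) (Fin.last n) :=
    ⟨hf.src_eq.symm, hyw.split_cons.2⟩
  set d : G.Path (G.src f') (Fin.last n) := ⟨f :: q, hd⟩ with hdd
  have hcd : y = c.append d := Subtype.ext hye
  rw [hcd, ← Path.append_assoc] at hxC hx'C
  have hxc : F.InListLT (x.append c).1 (e' :: c.1) := hx.append_right c.1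
  -- a route below the chosen one
  have hdown : ∃ b : G.Path (G.src f') (Fin.last n), (x.append c).append b ∈ C ∧
      F.OutListLT b.1 d.1 := by
    obtain ⟨k, hk, l, m, hke⟩ := exists_mem_through_edge hC f'
    have hkeq : k = l.append ⟨f' :: m.1, rfl, m.2⟩ := Subtype.ext hke
    rw [hkeq] at hk
    have hlt : F.OutListLT (f' :: m.1) d.1 := OutListLT.of_edge hf _ _
    rcases F.inListLT_trichotomy l.2 (x.append c).2 with h | h | h
    · rcases exists_mem_step_down hC hk hxC h hlt with h' | ⟨z, hzC, hz⟩
      · exact h'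
      -- The other outcome is a smaller initial part with the same `d`. By `hmin` that route also
      -- runs through `c`, which contradicts the minimality of `x`.
      · obtain ⟨p₂, q₂, e₂, f₂, hN, he₂, hf₂⟩ := hmin _ hzC
          (ListCW.of_split (x' := e' :: c.1) (hz.trans hxc)
            (OutListLT.of_edge hf [] q : F.OutListLT [f'] d.1))
        have hw := (z.append d).2
        rw [hN] at hw
        have hw1 : G.IsWalk 0 (p₂ ++ [e₂]) (G.tgt e') := he₂.tgt_eq ▸ hw.split_cons.1.snoc
        have hze := (IsWalk.split_unique (y := d.1) (y' := f₂ :: q₂) z.2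
          (hw1.append c.2) (hN.trans (by simp))).1
        obtain ⟨z', hz'⟩ : ∃ z' : G.Path 0 (G.tgt e'), z'.1 = p₂ ++ [e₂] := ⟨⟨_, hw1⟩, rfl⟩
        have hzeq : z = z'.append c := Subtype.ext (hze.trans (by rw [← hz']; rfl))
        rw [hzeq] at hzC hz
        rw [Path.append_assoc, ← hcd] at hzC
        have hlt := InListLT.cancel_right hz
        exact absurd hlt (hxmin _ ⟨hzC, hlt.trans hx⟩)
    · exact ⟨_, Subtype.ext h ▸ hk, hlt⟩
    · exact absurd (RouteCW.of_append h hlt) (hC.prop _ hxC _ hk)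
  obtain ⟨b₁, hb₁C, hb₁⟩ := hdown
  obtain ⟨b, ⟨hb, hbC⟩, hbmax⟩ := (F.wellFounded_outListLT_swap (G.src f') (Fin.last n)).has_min
    {b | F.OutListLT b.1 d.1 ∧ (x.append c).append b ∈ C} ⟨b₁, hb₁, hb₁C⟩
  -- Besides being the next initial part above `a`, `a'` is kept at or below `x' c`; this bound will
  -- show that `a` and `a'` do not part inside `c`.
  obtain ⟨a', ⟨ha', ha'C, ha'x⟩, hamin⟩ := (F.wellFounded_inListLT 0 (G.src f')).has_min
    {z | F.InListLT (x.append c).1 z.1 ∧ z.append d ∈ C ∧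
      (z = x'.append c ∨ F.InListLT z.1 (x'.append c).1)}
    ⟨x'.append c, hxx'.append_right _, hx'C, Or.inl rfl⟩
  refine ⟨x.append c, a', b, d, ⟨hbC, hxC, ha'C, ha', hb, fun z hz hz' hzC => ?_,
    fun z hz hz' hzC => hbmax z ⟨hz', hzC⟩ hz⟩, ⟨p, e, ?_, he⟩, ⟨f, q, rfl, hf⟩, x'.1, ?_⟩
  · refine hamin z ⟨hz, hzC, Or.inr ?_⟩ hz'
    rcases ha'x with h | h
    · exact h ▸ hz'
    · exact hz'.trans h
  · change x.1 ++ c.1 = _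
    simp [hxe]
  · exact ha'x.imp (fun h => congrArg Subtype.val h) id

/-- Below a larger maximal clique there is a rotation. -/
theorem exists_rotation {C C' : Set G.Route} (hC : Maximal (IsIndependent F.RouteCW) C)
    (hC' : Maximal (IsIndependent F.RouteCW) C')
    (hle : ∀ s ∈ C, ∀ t ∈ C', ¬ F.RouteCW t s) (hne : C ≠ C') :
    ∃ D, Maximal (IsIndependent F.RouteCW) D ∧ C ≠ D ∧
      (∃ R ∈ C, ∃ R', D = (C \ {R}) ∪ {R'} ∧ F.RouteCW R R') ∧
      ∀ s ∈ D, ∀ t ∈ C', ¬ F.RouteCW t s := by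
  have hr := F.isInterpolative_routeCW
  have hex : ∃ c : List E, ∃ N ∈ C, ∃ T ∈ C', ∃ p q p' q' e f e' f',
      N.1 = p ++ e :: (c ++ f :: q) ∧ T.1 = p' ++ e' :: (c ++ f' :: q') ∧ F.InEdgeLT e e' ∧
        F.OutEdgeLT f' f := by
    have : ∃ T ∈ C', T ∉ C := by
      by_contra! hcon
      exact hne (Set.Subset.antisymm (hC'.le_of_ge hC.prop hcon) hcon)
    obtain ⟨T, hT, hTC⟩ := this
    have : ∃ N ∈ C, F.RouteCW N T := by
      by_contra! hcon
      exact hTC (hr.mem_of_maximal hC fun N hN => ⟨hle N hN T hT, hcon N hN⟩)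
    obtain ⟨N, hN, p, c, q, p', q', e, f, e', f', h⟩ := this
    exact ⟨c, N, hN, T, hT, p, q, p', q', e, f, e', f', h⟩
  -- The common part `c` is chosen shortest among all pairs from `C` and `C'`, which supplies the
  -- hypothesis `hmin` of `exists_isCorner`.
  obtain ⟨c, ⟨N₀, hN₀, T, hT, p, q, p', q', e₀, f₀, e', f', hN₀e, hTe, he₀, hf₀⟩, hcmin⟩ :=
    (measure (List.length (α := E))).wf.has_min {c : List E | ∃ N ∈ C, ∃ T ∈ C',
      ∃ p q p' q' e f e' f', N.1 = p ++ e :: (c ++ f :: q) ∧ T.1 = p' ++ e' :: (c ++ f' :: q') ∧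
        F.InEdgeLT e e' ∧ F.OutEdgeLT f' f} hex
  have hTw := T.2
  rw [hTe] at hTw
  have hcw : G.IsWalk (G.tgt e') c (G.src f') := hTw.split_cons.2.split_cons.1
  obtain ⟨a, a', b, d, hcor, ⟨p₁, e₁, ha, he₁⟩, ⟨f₁, q₁, hd, hf₁⟩, x, hx⟩ :=
    exists_isCorner hC ⟨c, hcw⟩ (by
      rintro N hN ⟨P, c₁, Q, P', Q', e₁, f₁, e₂, f₂, hNe, hce, he, hf⟩
      -- A relation with part of the path `e' c f'` is also a relation with `T`, so its common part
      -- is no shorter than `c` and must be all of `c`.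
      have hlen : ¬ c₁.length < c.length := by
        refine hcmin c₁ ⟨N, hN, T, hT, P, Q, p' ++ P', Q' ++ q', e₁, f₁, e₂, f₂, hNe, ?_, he, hf⟩
        have h1 : T.1 = p' ++ (e' :: (c ++ [f'])) ++ q' := by simp [hTe]
        rw [h1, hce]
        simp
      have hl := congrArg List.length hce
      simp only [List.length_cons, List.length_append, List.length_nil] at hl
      obtain rfl : P' = [] := List.length_eq_zero_iff.1 (by omega)
      obtain rfl : Q' = [] := List.length_eq_zero_iff.1 (by simp at hl; omega)
      simp only [List.nil_append, List.cons.injEq] at hce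
      obtain ⟨rfl, hce⟩ := hce
      obtain ⟨rfl, h2⟩ := List.append_inj' hce rfl
      cases h2
      exact ⟨P, Q, e₁, f₁, hNe, he, hf⟩)
      ⟨N₀, hN₀, p, c, q, [], [], e₀, f₀, e', f', hN₀e, rfl, he₀, hf₀⟩
  simp only at ha hx
  obtain ⟨A, A', cl, g, g', hag, hag', hgg'⟩ := hcor.in_lt
  obtain ⟨cr, B, D₁, h, h', hbh, hdh, hhh'⟩ := hcor.out_lt
  -- the path common to the flipped corner, extended to a route
  have hPw : G.IsWalk (G.src g') (g' :: cl ++ (cr ++ [h])) (G.tgt h) := by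
    have h1 := a'.2
    rw [hag'] at h1
    have h2 := b.2
    rw [hbh] at h2
    exact IsWalk.append (l := g' :: cl) ⟨rfl, h1.split_cons.2⟩ h2.split_cons.1.snoc
  -- The dual framing is used because the extension must not create new routes clockwise from `P`.
  obtain ⟨l, m, P, hPe, hP⟩ := F.dual.exists_route_extending hPw
  simp only [dual_listCW] at hP
  -- Such a `t` would follow `a d` from `e₁` through `c` to `f₁`, and hence would be clockwise from
  -- `T` in the clique `C'`.
  have hPC' : ∀ t ∈ C', ¬ F.RouteCW t P := by
    intro t ht htP
    obtain ⟨t₁, t₂, r, s, rfl, -, -, -, -, h1, h2⟩ := hcor.exists_of_listCW hC hag hag' hbh hdh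
      (hle _ hcor.mem_down t ht) (hle _ hcor.mem_right t ht) (hP _ htP)
    refine hC'.prop _ ht _ hT ?_
    have h3 : F.InListLT t₁.1 ((p' ++ [e']) ++ c) := by
      -- If `a` and `a'` parted inside `c`, then `a'` would lie above every path ending in `c`,
      -- against `hx`.
      have hlen : c.length ≤ cl.length := by
        by_contra hlt
        have h4 : p₁ ++ e₁ :: c = A ++ g :: cl := ha.symm.trans hag
        have : ∃ c₂, c = c₂ ++ g :: cl := by
          have h5 : c <:+ A ++ g :: cl := ⟨p₁ ++ [e₁], by simp [← h4]⟩
          have h6 : (g :: cl) <:+ c :=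
            List.suffix_of_suffix_length_le (List.suffix_append A _) h5
              (by simp only [List.length_cons]; omega)
          exact h6.imp fun _ h => h.symm
        obtain ⟨c₂, hc₂⟩ := this
        have h5 : F.InListLT (x ++ c) a'.1 := by
          rw [hag', hc₂, ← List.append_assoc]
          exact InListLT.of_edge hgg' _ _ _
        rcases hx with hx | hx
        · exact InListLT.irrefl _ (hx ▸ h5)
        · exact h5.asymm hx
      have h4 : (e₁ :: c) <:+ g :: cl :=
        List.suffix_of_suffix_length_le (l₃ := a.1) ⟨p₁, ha.symm⟩ ⟨A, hag.symm⟩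
          (by simpa using hlen)
      obtain ⟨c₂, hc₂⟩ := h4
      rw [h1, ← hc₂, ← List.append_assoc, List.append_assoc p', List.singleton_append]
      simpa using InListLT.of_edge he₁ (r ++ c₂) p' c
    have h4 : F.OutListLT (f' :: q') t₂.1 := by
      have h5 : cr ++ h' :: D₁ = f₁ :: q₁ := hdh.symm.trans hd
      rw [h2]
      cases cr with
      | nil =>
        simp only [List.nil_append, List.cons.injEq] at h5
        rw [h5.1]
        exact OutListLT.of_edge hf₁ _ _
      | cons k cr =>
        simp only [List.cons_append, List.cons.injEq] at h5
        rw [h5.1]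
        exact OutListLT.of_edge hf₁ _ _
    rw [RouteCW, hTe]
    change F.ListCW (t₁.1 ++ t₂.1) _
    simpa using ListCW.of_split h3 h4
  have hNP : F.RouteCW (a.append d) P := by
    have h1 := (ListCW.of_split (InListLT.of_edge hgg' A [] cl)
      ((OutListLT.of_edge hhh' [] D₁).append_left cr)).mono [] [] l.1 m.1
    rw [RouteCW, hPe]
    have h2 : (a.append d).1 = (A ++ g :: cl) ++ (cr ++ h' :: D₁) := by
      rw [← hag, ← hdh]
      rfl
    rw [h2]
    simpa using h1
  have hPN' : ¬ F.RouteCW (a'.append b) P := by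
    intro h1
    refine ListCW.irrefl (a'.append b).2 (F := F) ?_
    have h2 := (hP _ h1).mono [] [] A' B
    have h3 : (a'.append b).1 = A' ++ (g' :: cl ++ (cr ++ [h])) ++ B := by
      change a'.1 ++ b.1 = _
      rw [hag', hbh]
      simp
    rw [← h3] at h2
    simpa using h2
  have hPC : ∀ k ∈ C, k ≠ a.append d → ¬ F.RouteCW k P := by
    intro k hk hkN hkP
    obtain ⟨t₁, t₂, -, -, rfl, h1, h2, h3, h4, -, -⟩ := hcor.exists_of_listCW hC hag hag' hbh hdh
      (hC.prop _ hk _ hcor.mem_down) (hC.prop _ hk _ hcor.mem_right) (hP _ hkP)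
    -- The bounds `a ≤ t₁ < a'` and `b < t₂ ≤ d`, with consecutiveness and coherence with `a d`,
    -- leave only `a d` itself.
    rcases F.inListLT_trichotomy a.2 t₁.2 with h5 | h5 | h5
    · rcases F.outListLT_trichotomy t₂.2 d.2 with h6 | h6 | h6
      · exact hC.prop _ hcor.mem _ hk (RouteCW.of_append h5 h6)
      · exact hcor.no_in t₁ h5 h1 (Subtype.ext h6 ▸ hk)
      · exact h4 h6
    · cases (Subtype.ext h5 : a = t₁)
      rcases F.outListLT_trichotomy t₂.2 d.2 with h6 | h6 | h6
      · exact hcor.no_out t₂ h2 h6 hk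
      · exact hkN (by rw [(Subtype.ext h6 : t₂ = d)])
      · exact h4 h6
    · exact h3 h5
  -- the largest maximal clique below both the flip of `C` and `C'`
  set S : Set G.Route := (C \ {a.append d}) ∪ {a'.append b} ∪ C' with hS
  set D := freeHull (flip F.RouteCW) S with hDdef
  have hD : Maximal (IsIndependent F.RouteCW) D := hr.maximal_freeHull_flip S
  have hPS : P ∈ rightFree F.RouteCW S := by
    rintro s ((⟨hs, hsN⟩ | rfl) | hs)
    · exact hPC s hs hsN
    · exact hPN'
    · exact hPC' s hs
  -- The route `P` separates: nothing in `S` is clockwise from it, but `a d` is. This forces the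
  -- meet `D` to drop `a d`.
  have hND : a.append d ∉ D := fun hN => hN.2 P hPS hNP
  have hCD : C \ {a.append d} ⊆ D := by
    rintro z ⟨hz, hzN⟩
    refine ⟨?_, fun q hq => hq z (Or.inl (Or.inl ⟨hz, hzN⟩))⟩
    rintro s ((⟨hs, -⟩ | rfl) | hs)
    · exact hC.prop s hs z hz
    · intro h1
      rcases RouteCW.of_append_left h1 with ⟨z₁, z₂, rfl, h2, h3⟩ | h2 | h2
      · exact hC.prop _ hcor.mem_down _ hz (RouteCW.of_append (hcor.in_lt.trans h2) h3)
      · exact not_in_listCW (hC.prop _ hcor.mem_right _ hz) h2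
      · exact not_out_listCW (hC.prop _ hcor.mem_down _ hz) h2
    · exact hle z hz s hs
  have hDC : ∀ t ∈ D, t ∉ C → t = a'.append b := by
    intro t ht htC
    refine hcor.eq_of_coherent hC htC fun k hk hkN => ?_
    have hkD := hCD ⟨hk, hkN⟩
    exact ⟨hD.prop k hkD t ht, hD.prop t ht k hkD⟩
  have hCneD : C ≠ D := fun h1 => hND (h1 ▸ hcor.mem)
  refine ⟨D, hD, hCneD, ⟨a.append d, hcor.mem, a'.append b, ?_, hcor.routeCW⟩,
    fun s hs t ht => hs.1 t (Or.inr ht)⟩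
  refine Set.Subset.antisymm (fun t ht => ?_) (Set.union_subset hCD ?_)
  · by_cases htC : t ∈ C
    · refine Or.inl ⟨htC, ?_⟩
      rintro rfl
      exact hND ht
    · exact Or.inr (hDC t ht htC)
  · have : ∃ t ∈ D, t ∉ C := by
      by_contra! hcon
      exact hCneD (Set.Subset.antisymm (hD.le_of_ge hC.prop hcon) hcon)
    obtain ⟨t, ht, htC⟩ := this
    rw [Set.singleton_subset_iff, ← hDC t ht htC]
    exact ht

end Framing

end FlowGraph

namespace FlowGraph

variable {n : ℕ} {E : Type*} {G : FlowGraph n E}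

namespace Framing

variable {F : G.Framing}

/-! ### The greedy algorithm -/

theorem coherent_iff {P Q : G.Route} :
    F.Coherent P Q ↔ ¬ F.RouteCW P Q ∧ ¬ F.RouteCW Q P := by
  rw [RouteCW, RouteCW, ← exists_cw_iff, ← exists_cw_iff, not_exists, not_exists, ← forall_and]
  rfl

theorem isClique_eq : F.IsClique = IsIndependent F.RouteCW := by
  funext C
  refine propext ⟨fun h P hP Q hQ => (coherent_iff.1 (h P hP Q hQ)).1, fun h P hP Q hQ => ?_⟩
  exact coherent_iff.2 ⟨h P hP Q hQ, h Q hQ P hP⟩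

variable (F) in
theorem addFirst_spec {β : Type*} (f : β → G.Route) (Rem S : Set G.Route) (L : List β) :
    (F.addFirst Rem S (L.map f) = S ∧
      ∀ b ∈ L, ¬ ((∀ Q ∈ S, F.Coherent (f b) Q) ∧ f b ∉ Rem)) ∨
    ∃ L₁ b L₂, L = L₁ ++ b :: L₂ ∧ F.addFirst Rem S (L.map f) = S ∪ {f b} ∧
      ((∀ Q ∈ S, F.Coherent (f b) Q) ∧ f b ∉ Rem) ∧
      ∀ b' ∈ L₁, ¬ ((∀ Q ∈ S, F.Coherent (f b') Q) ∧ f b' ∉ Rem) := by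
  induction L with
  | nil => exact Or.inl ⟨rfl, by simp⟩
  | cons b L ih =>
    by_cases hb : (∀ Q ∈ S, F.Coherent (f b) Q) ∧ f b ∉ Rem
    · exact Or.inr ⟨[], b, L, rfl, by rw [List.map_cons, addFirst, if_pos hb], hb, by simp⟩
    · rw [List.map_cons, addFirst, if_neg hb]
      rcases ih with ⟨h1, h2⟩ | ⟨L₁, b', L₂, rfl, h1, h2, h3⟩
      · refine Or.inl ⟨h1, ?_⟩
        rintro c (_ | ⟨_, hc⟩)
        · exact hb
        · exact h2 c hc
      · refine Or.inr ⟨b :: L₁, b', L₂, rfl, h1, h2, ?_⟩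
        rintro c (_ | ⟨_, hc⟩)
        · exact hb
        · exact h3 c hc

/-- The set `T` contains the first route of `J` which begins with `A`. -/
def ContainsFirst (F : G.Framing) (J T : Set G.Route) {v : Fin (n + 1)} (A : G.Path 0 v) : Prop :=
  ∀ B : G.Path v (Fin.last n), A.append B ∈ J →
    ∃ B₀ : G.Path v (Fin.last n), A.append B₀ ∈ T ∧ (B₀ = B ∨ F.OutListLT B₀.1 B.1)

theorem ContainsFirst.mono {J T T' : Set G.Route} {v : Fin (n + 1)} {A : G.Path 0 v}
    (h : F.ContainsFirst J T A) (hT : T ⊆ T') : F.ContainsFirst J T' A := by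
  intro B hB
  obtain ⟨B₀, h1, h2⟩ := h B hB
  exact ⟨B₀, hT h1, h2⟩

variable (F) in
/-- A maximal clique `J` avoiding `Rem`, such that everything counterclockwise from `J` belongs to
`Rem` and the complement of `Rem` is closed under splicing. -/
structure IsGreedyTarget (J Rem : Set G.Route) : Prop where
  independent : IsIndependent F.RouteCW J
  mem : ∀ R, (∀ K ∈ J, ¬ F.RouteCW R K ∧ ¬ F.RouteCW K R) → R ∈ J
  notMem_rem : ∀ K ∈ J, K ∉ Rem
  mem_rem : ∀ K ∈ J, ∀ R, F.RouteCW K R → R ∈ Rem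
  splice : ∀ {v : Fin (n + 1)} {x x' : G.Path 0 v} {y y' : G.Path v (Fin.last n)},
    x.append y ∉ Rem → x'.append y' ∉ Rem → F.InListLT x.1 x'.1 → F.OutListLT y'.1 y.1 →
      x.append y' ∉ Rem

namespace IsGreedyTarget

variable {J Rem : Set G.Route}

/-- The invariant is that the current set lies in `J` and contains, for each treated initial part,
the first route of `J` with that beginning. The crux is that the selected route lies in `J`: no
route of `J` can be clockwise from it, because of `Rem`. -/
theorem addFirst (h : F.IsGreedyTarget J Rem) {v : Fin (n + 1)}
    {outs : List (G.Path v (Fin.last n))} (hmem : ∀ B, B ∈ outs) (hsort : outs.Pairwise fun B B' => ¬ F.OutListLT B'.1 B.1)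
    {A : G.Path 0 v} {T : Set G.Route} (hT : T ⊆ J)
    (hlt : ∀ u < v, ∀ A' : G.Path 0 u, F.ContainsFirst J T A')
    (heq : ∀ A' : G.Path 0 v, F.InListLT A.1 A'.1 → F.ContainsFirst J T A') :
    T ⊆ F.addFirst Rem T (outs.map fun B => A.append B) ∧
      F.addFirst Rem T (outs.map fun B => A.append B) ⊆ J ∧
      F.ContainsFirst J (F.addFirst Rem T (outs.map fun B => A.append B)) A := by
  have hcand : ∀ K ∈ J, (∀ Q ∈ T, F.Coherent K Q) ∧ K ∉ Rem := fun K hK =>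
    ⟨fun Q hQ => coherent_iff.2 ⟨h.independent K hK Q (hT hQ), h.independent Q (hT hQ) K hK⟩,
      h.notMem_rem K hK⟩
  rcases F.addFirst_spec (fun B => A.append B) Rem T outs with
    ⟨h1, h2⟩ | ⟨L₁, B, L₂, hL, h1, ⟨h2, h3⟩, h4⟩
  · rw [h1]
    exact ⟨subset_rfl, hT, fun B hB => absurd (hcand _ hB) (h2 B (hmem B))⟩
  rw [hL, List.pairwise_append, List.pairwise_cons] at hsort
  have hAB : A.append B ∈ J := by
    by_contra hcon
    have : ∃ K ∈ J, F.RouteCW (A.append B) K := by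
      by_contra! hK
      exact hcon (h.mem _ fun K hKJ => ⟨hK K hKJ, fun hlt => h3 (h.mem_rem K hKJ _ hlt)⟩)
    obtain ⟨K, hK, hlt'⟩ := this
    obtain ⟨w, a, a', b, b', hab, rfl, hin, hout⟩ := ListCW.exists_append hlt'
    -- If `a'` was already treated, `T` contains `a' B₀` with `B₀` at or before `b'`, and `A B` is
    -- clockwise from it, although it was tested against `T`.
    have hfirst : ¬ F.ContainsFirst J T a' := by
      intro hf
      obtain ⟨B₀, hB₀, hB₀'⟩ := hf b' hK
      refine (coherent_iff.1 (h2 _ hB₀)).1 ?_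
      rw [hab]
      refine RouteCW.of_append hin ?_
      rcases hB₀' with rfl | hB₀'
      · exact hout
      · exact hB₀'.trans hout
    rcases lt_trichotomy w v with hw | rfl | hw
    · exact hfirst (hlt w hw a')
    · obtain ⟨rfl, rfl⟩ := Path.append_inj hab
      exact hfirst (heq a' hin)
    · have hl : A.1 ++ B.1 = a.1 ++ b.1 := congrArg Subtype.val hab
      rcases List.append_eq_append_iff.1 hl with ⟨c, hc, hB⟩ | ⟨c, hc, -⟩
      · obtain ⟨v', hv, hcw⟩ := (hc ▸ a.2).split
        obtain rfl : v' = v := hv.end_unique A.2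
        obtain ⟨B', hB'⟩ : ∃ B' : G.Path v' (Fin.last n), B'.1 = c ++ b'.1 :=
          ⟨⟨c ++ b'.1, hcw.append b'.2⟩, rfl⟩
        have hAB' : A.append B' = a.append b' := Subtype.ext (by
          change A.1 ++ B'.1 = a.1 ++ b'.1
          rw [hB', hc, List.append_assoc])
        have hlt : F.OutListLT B'.1 B.1 := by
          rw [hB', hB]
          exact hout.append_left c
        have hB'L : B' ∈ L₁ := by
          have := hmem B'
          rw [hL, List.mem_append, List.mem_cons] at this
          rcases this with h5 | rfl | h5
          · exact h5
          · exact absurd hlt (OutListLT.irrefl _)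
          · exact absurd hlt (hsort.2.1.1 B' h5)
        -- The remaining case is incoherence after `v`. Following `K` from `w` on gives an earlier
        -- candidate `A B'` that also passes the test, so `B` was not the first.
        refine h4 B' hB'L ⟨fun Q hQ => ?_, ?_⟩
        · change F.Coherent (A.append B') Q
          have h5 := coherent_iff.1 (h2 Q hQ)
          change ¬ F.RouteCW (A.append B) Q ∧ ¬ F.RouteCW Q (A.append B) at h5
          rw [hab] at h5
          have h6 := h.independent _ hK Q (hT hQ)
          have h7 := h.independent Q (hT hQ) _ hK
          rw [hAB', coherent_iff]
          constructor
          · intro h8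
            rcases h8.of_append_left with ⟨q₁, q₂, rfl, h9, h10⟩ | h9 | h9
            · exact h5.1 (RouteCW.of_append h9 (h10.trans hout))
            · exact not_in_listCW h5.1 h9
            · exact not_out_listCW h6 h9
          · intro h8
            rcases h8.of_append_right with ⟨q₁, q₂, rfl, h9, h10⟩ | h9 | h9
            · exact h7 (RouteCW.of_append (h9.trans hin) h10)
            · exact not_listCW_in h5.2 h9
            · exact not_listCW_out h7 h9
        · change A.append B' ∉ Rem
          rw [hAB']
          refine h.splice ?_ (h.notMem_rem _ hK) hin hout
          exact hab ▸ h3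
      · obtain ⟨v', hv, hcw⟩ := (hc ▸ A.2).split
        cases hv.end_unique a.2
        exact absurd hcw.le hw.not_ge
  rw [h1]
  refine ⟨Set.subset_union_left, Set.union_subset hT (Set.singleton_subset_iff.2 hAB),
    fun B' hB' => ⟨B, Or.inr rfl, ?_⟩⟩
  have := hmem B'
  rw [hL, List.mem_append, List.mem_cons] at this
  rcases this with h5 | rfl | h5
  · exact absurd (hcand _ hB') (h4 B' h5)
  · exact Or.inl rfl
  · rcases F.outListLT_trichotomy B.2 B'.2 with h6 | h6 | h6
    · exact Or.inr h6
    · exact Or.inl (Subtype.ext h6)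
    · exact absurd h6 (hsort.2.1.1 B' h5)

theorem foldl_in (h : F.IsGreedyTarget J Rem) {v : Fin (n + 1)}
    {outs : List (G.Path v (Fin.last n))} (hmem : ∀ B, B ∈ outs)
    (hsort : outs.Pairwise fun B B' => ¬ F.OutListLT B'.1 B.1) (L : List (G.Path 0 v))
    (hL : L.Pairwise fun A A' => ¬ F.InListLT A.1 A'.1) {T : Set G.Route} (hT : T ⊆ J)
    (hlt : ∀ u < v, ∀ A' : G.Path 0 u, F.ContainsFirst J T A')
    (heq : ∀ A' : G.Path 0 v, A' ∉ L → F.ContainsFirst J T A') :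
    T ⊆ L.foldl (fun T P => F.addFirst Rem T (outs.map fun Q => P.append Q)) T ∧
      L.foldl (fun T P => F.addFirst Rem T (outs.map fun Q => P.append Q)) T ⊆ J ∧
      ∀ A' : G.Path 0 v, F.ContainsFirst J
        (L.foldl (fun T P => F.addFirst Rem T (outs.map fun Q => P.append Q)) T) A' := by
  induction L generalizing T with
  | nil => exact ⟨subset_rfl, hT, fun A' => heq A' (by simp)⟩
  | cons A L ih =>
    rw [List.pairwise_cons] at hL
    obtain ⟨h1, h2, h3⟩ := h.addFirst hmem hsort (A := A) hT hlt (fun A' hA' => heq A' (by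
      rw [List.mem_cons]
      rintro (rfl | h4)
      · exact InListLT.irrefl _ hA'
      · exact hL.1 A' h4 hA'))
    obtain ⟨h4, h5, h6⟩ := ih hL.2 h2 (fun u hu A' => (hlt u hu A').mono h1) (fun A' hA' => by
      by_cases hAA' : A' = A
      · exact hAA' ▸ h3
      · exact (heq A' (by simp [hA', hAA'])).mono h1)
    exact ⟨h1.trans h4, h5, h6⟩

theorem foldl_vertices (h : F.IsGreedyTarget J Rem) {ins : ∀ v, List (G.Path 0 v)}
    {outs : ∀ v, List (G.Path v (Fin.last n))} (hins : ∀ v A, A ∈ ins v)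
    (hins' : ∀ v, (ins v).Pairwise fun A A' => ¬ F.InListLT A.1 A'.1)
    (houts : ∀ v B, B ∈ outs v)
    (houts' : ∀ v, (outs v).Pairwise fun B B' => ¬ F.OutListLT B'.1 B.1)
    (L : List (Fin (n + 1))) (hL : L.Pairwise (· < ·)) {T : Set G.Route} (hT : T ⊆ J)
    (hdone : ∀ u ∉ L, ∀ A' : G.Path 0 u, F.ContainsFirst J T A') :
    L.foldl (fun T v => (ins v).foldl
        (fun T P => F.addFirst Rem T ((outs v).map fun Q => P.append Q)) T) T ⊆ J ∧
      ∀ u, ∀ A' : G.Path 0 u, F.ContainsFirst J (L.foldl (fun T v => (ins v).foldl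
        (fun T P => F.addFirst Rem T ((outs v).map fun Q => P.append Q)) T) T) A' := by
  induction L generalizing T with
  | nil => exact ⟨hT, fun u A' => hdone u (by simp) A'⟩
  | cons v L ih =>
    rw [List.pairwise_cons] at hL
    obtain ⟨h1, h2, h3⟩ := h.foldl_in (houts v) (houts' v) (ins v) (hins' v) hT
      (fun u hu => hdone u (by
        rw [List.mem_cons]
        rintro (rfl | h4)
        · exact lt_irrefl _ hu
        · exact lt_asymm hu (hL.1 u h4)))
      (fun A' hA' => absurd (hins v A') hA')
    refine ih hL.2 h2 fun u hu A' => ?_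
    by_cases huv : u = v
    · subst huv
      exact h3 A'
    · exact (hdone u (by simp [hu, huv]) A').mono h1

theorem greedy_eq (h : F.IsGreedyTarget J Rem) {ins : ∀ v, List (G.Path 0 v)}
    {outs : ∀ v, List (G.Path v (Fin.last n))} (hins : ∀ v A, A ∈ ins v)
    (hins' : ∀ v, (ins v).Pairwise fun A A' => ¬ F.InListLT A.1 A'.1)
    (houts : ∀ v B, B ∈ outs v)
    (houts' : ∀ v, (outs v).Pairwise fun B B' => ¬ F.OutListLT B'.1 B.1)
    {X : Set G.Route} (hX : X ⊆ J) : F.greedy ins outs Rem X = J := by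
  obtain ⟨h1, h2⟩ := h.foldl_vertices hins hins' houts houts' (List.finRange (n + 1))
    (List.pairwise_lt_finRange (n + 1)) hX (fun u hu => absurd (List.mem_finRange u) hu)
  refine Set.Subset.antisymm h1 fun K hK => ?_
  -- At the sink the initial parts are whole routes, so the invariant there gives all of `J`.
  have hKe : ∀ B : G.Path (Fin.last n) (Fin.last n), Path.append K B = K := fun B =>
    Subtype.ext (by
      change K.1 ++ B.1 = K.1
      rw [IsWalk.not_leaving_last B.2, List.append_nil])
  obtain ⟨B⟩ : Nonempty (G.Path (Fin.last n) (Fin.last n)) := ⟨⟨[], rfl⟩⟩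
  obtain ⟨B₀, hB₀, -⟩ := h2 (Fin.last n) K B (by rwa [hKe])
  rwa [hKe] at hB₀

end IsGreedyTarget

/-! ### The greedy sets are hulls -/

theorem ccw_dual {a b : Fin (n + 1)} (P : G.Path a b) : F.dual.ccw P = F.cw P := by
  ext R
  exact exists_cw_iff.trans (dual_listCW.trans exists_cw_iff.symm)

theorem RemCCW_dual (C C' : Set G.Route) : F.dual.RemCCW C C' = F.RemCW C C' := by
  simp only [RemCCW, RemCW, ccw_dual]

theorem addFirst_dual : F.dual.addFirst = F.addFirst := by
  funext Rem S L
  have h : ∀ P Q : G.Route, F.dual.Coherent P Q ↔ F.Coherent P Q := by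
    intro P Q
    rw [coherent_iff, coherent_iff, routeCW_dual]
    exact and_comm
  induction L with
  | nil => rfl
  | cons R L ih =>
    rw [addFirst, addFirst, ih]
    classical exact if_congr (by simp only [h]) rfl rfl

theorem maximal_isClique_iff {C : Set G.Route} :
    Maximal F.IsClique C ↔ Maximal (IsIndependent F.RouteCW) C := by
  rw [isClique_eq]

theorem MaxClique.maximal (C : F.MaxClique) : Maximal (IsIndependent F.RouteCW) C.1 :=
  maximal_isClique_iff.1 C.2

section Finite

variable [Finite E]

/-- Extending a path extremally to a route adds nothing counterclockwise from it outside `ccw P` and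
loses nothing. Thus only routes `P` matter, and the condition on them is membership in `leftFree`.
-/
theorem mem_RemCCW {C C' : Set G.Route} {R : G.Route} :
    R ∈ F.RemCCW C C' ↔ R ∉ rightFree F.RouteCW (leftFree F.RouteCW (C ∪ C')) := by
  constructor
  · rintro ⟨a, b, P, hP, hR⟩ hcon
    obtain ⟨l, m, r, hre, hr⟩ := F.exists_route_extending P.2
    refine hcon r (fun s hs hrs => ?_) ?_
    · exact Set.eq_empty_iff_forall_notMem.1 hP s ⟨exists_cw_iff.2 (hr _ hrs), hs⟩
    · rw [RouteCW, hre]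
      exact ((exists_cw_iff.1 hR).right_append m.1).left_append l.1
  · intro h
    simp only [rightFree, Set.mem_ofPred_eq, not_forall, not_not] at h
    obtain ⟨q, hq, hqR⟩ := h
    refine ⟨_, _, q, Set.eq_empty_iff_forall_notMem.2 ?_, exists_cw_iff.2 hqR⟩
    rintro s ⟨h1, h2⟩
    exact hq s h2 (exists_cw_iff.1 h1)

theorem greedy_eq_freeHull {C C' : Set G.Route} (hC : IsIndependent F.RouteCW C)
    (hC' : IsIndependent F.RouteCW C') {ins : ∀ v, List (G.Path 0 v)}
    {outs : ∀ v, List (G.Path v (Fin.last n))} (hins : ∀ v A, A ∈ ins v)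
    (hins' : ∀ v, (ins v).Pairwise fun A A' => ¬ F.InListLT A.1 A'.1)
    (houts : ∀ v B, B ∈ outs v)
    (houts' : ∀ v, (outs v).Pairwise fun B B' => ¬ F.OutListLT B'.1 B.1) :
    F.greedy ins outs (F.RemCCW C C') (C ∩ C') = freeHull F.RouteCW (C ∪ C') := by
  have hr := F.isInterpolative_routeCW
  have hJ := hr.maximal_freeHull (C ∪ C')
  have h : F.IsGreedyTarget (freeHull F.RouteCW (C ∪ C')) (F.RemCCW C C') :=
    { independent := hJ.prop
      mem := fun R hR => hr.mem_of_maximal hJ hR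
      notMem_rem := fun K hK hKR => mem_RemCCW.1 hKR hK.2
      mem_rem := fun K hK R hKR => mem_RemCCW.2 fun hR => hR K hK.1 hKR
      splice := fun {v x x' y y'} h1 h2 h3 h4 => by
        rw [mem_RemCCW, not_not] at *
        exact rightFree_splice h1 h2 rfl rfl h3 h4 (Or.inr rfl) }
  -- The start `C ∩ C'` lies in the hull: its routes are unrelated to `C` and to `C'`.
  refine h.greedy_eq hins hins' houts houts' fun R hR => ⟨?_, ?_⟩
  · rintro s (hs | hs)
    · exact hC R hR.1 s hs
    · exact hC' R hR.2 s hs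
  · exact subset_rightFree_leftFree _ (Or.inl hR.1)

theorem mem_pathList {u v : Fin (n + 1)} (P : G.Path u v) : P ∈ pathList G u v := by
  simp [pathList]

theorem mem_inPaths {v : Fin (n + 1)} (P : G.Path 0 v) : P ∈ F.inPaths v := by
  rw [inPaths, List.mem_mergeSort]
  exact mem_pathList P

theorem mem_outPaths {v : Fin (n + 1)} (P : G.Path v (Fin.last n)) : P ∈ F.outPaths v := by
  rw [outPaths, List.mem_mergeSort]
  exact mem_pathList P

variable (F) in
theorem pairwise_inPaths (v : Fin (n + 1)) :
    (F.inPaths v).Pairwise fun A A' => ¬ F.InListLT A'.1 A.1 := by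
  classical
  have h := List.pairwise_mergeSort (le := fun P Q : G.Path 0 v => decide (F.InLE P Q)) ?_ ?_ (pathList G 0 v)
  · exact h.imp fun h => of_decide_eq_true h
  · intro P Q R h1 h2
    rw [decide_eq_true_eq] at *
    intro (h3 : F.InListLT R.1 P.1)
    rcases F.inListLT_trichotomy P.2 Q.2 with h4 | h4 | h4
    · exact h2 (h3.trans h4)
    · exact h2 (by rw [← Subtype.ext h4]; exact h3)
    · exact h1 h4
  · intro P Q
    rw [Bool.or_eq_true, decide_eq_true_eq, decide_eq_true_eq]
    by_contra! hcon
    exact InListLT.asymm (not_not.1 hcon.1) (not_not.1 hcon.2)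

variable (F) in
theorem pairwise_outPaths (v : Fin (n + 1)) :
    (F.outPaths v).Pairwise fun B B' => ¬ F.OutListLT B'.1 B.1 := by
  classical
  have h := List.pairwise_mergeSort (le := fun P Q : G.Path v (Fin.last n) => decide (F.OutLE P Q)) ?_ ?_ (pathList G v (Fin.last n))
  · exact h.imp fun h => of_decide_eq_true h
  · intro P Q R h1 h2
    rw [decide_eq_true_eq] at *
    intro (h3 : F.OutListLT R.1 P.1)
    rcases F.outListLT_trichotomy P.2 Q.2 with h4 | h4 | h4
    · exact h2 (h3.trans h4)
    · exact h2 (by rw [← Subtype.ext h4]; exact h3)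
    · exact h1 h4
  · intro P Q
    rw [Bool.or_eq_true, decide_eq_true_eq, decide_eq_true_eq]
    by_contra! hcon
    exact OutListLT.asymm (not_not.1 hcon.1) (not_not.1 hcon.2)

theorem CmaxRem_eq_freeHull {C C' : Set G.Route} (hC : IsIndependent F.RouteCW C)
    (hC' : IsIndependent F.RouteCW C') :
    F.CmaxRem C C' = freeHull F.RouteCW (C ∪ C') := by
  refine greedy_eq_freeHull hC hC' (fun v A => List.mem_reverse.2 (mem_inPaths A)) (fun v => ?_)
    (fun v => mem_outPaths) F.pairwise_outPaths
  exact List.pairwise_reverse.2 (F.pairwise_inPaths v)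

theorem CminRem_eq_freeHull {C C' : Set G.Route} (hC : IsIndependent F.RouteCW C)
    (hC' : IsIndependent F.RouteCW C') :
    F.CminRem C C' = freeHull (flip F.RouteCW) (C ∪ C') := by
  have h : F.CminRem C C' = F.dual.greedy (fun v => F.inPaths v) (fun v => (F.outPaths v).reverse)
      (F.dual.RemCCW C C') (C ∩ C') := by
    rw [CminRem, RemCCW_dual, greedy, greedy, addFirst_dual]
  rw [h, ← routeCW_dual]
  refine greedy_eq_freeHull ?_ ?_ (fun v => mem_inPaths) (fun v => ?_)
    (fun v B => List.mem_reverse.2 (mem_outPaths B)) (fun v => ?_)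
  · rw [routeCW_dual]
    exact isIndependent_flip.2 hC
  · rw [routeCW_dual]
    exact isIndependent_flip.2 hC'
  · simpa only [dual_inListLT] using F.pairwise_inPaths v
  · simpa only [dual_outListLT, List.pairwise_reverse] using F.pairwise_outPaths v

/-! ### The framing lattice -/

variable (F) in
/-- The lattice of maximal cliques. -/
abbrev framingLattice : Lattice F.MaxClique where
  le C D := leftFree F.RouteCW D.1 ⊆ leftFree F.RouteCW C.1
  le_refl C := subset_rfl
  le_trans C D D' h h' := h'.trans h
  le_antisymm C D h h' := Subtype.ext
    (F.isInterpolative_routeCW.eq_of_leftFree_eq C.maximal D.maximal (h'.antisymm h))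
  sup C D := ⟨freeHull F.RouteCW (C.1 ∪ D.1),
    maximal_isClique_iff.2 (F.isInterpolative_routeCW.maximal_freeHull _)⟩
  le_sup_left C D := by
    rw [F.isInterpolative_routeCW.leftFree_freeHull, leftFree_union]
    exact Set.inter_subset_left
  le_sup_right C D := by
    rw [F.isInterpolative_routeCW.leftFree_freeHull, leftFree_union]
    exact Set.inter_subset_right
  sup_le C D D' h h' := by
    rw [F.isInterpolative_routeCW.leftFree_freeHull, leftFree_union]
    exact Set.subset_inter h h'
  inf C D := ⟨freeHull (flip F.RouteCW) (C.1 ∪ D.1),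
    maximal_isClique_iff.2 (F.isInterpolative_routeCW.maximal_freeHull_flip _)⟩
  inf_le_left C D := by
    -- The meet is a hull for `flip`, so it is controlled by `rightFree`, in terms of which the
    -- order is inclusion.
    rw [F.isInterpolative_routeCW.leftFree_subset_iff_rightFree
      (F.isInterpolative_routeCW.maximal_freeHull_flip _) C.maximal,
      F.isInterpolative_routeCW.rightFree_freeHull_flip, rightFree_union]
    exact Set.inter_subset_left
  inf_le_right C D := by
    rw [F.isInterpolative_routeCW.leftFree_subset_iff_rightFree
      (F.isInterpolative_routeCW.maximal_freeHull_flip _) D.maximal,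
      F.isInterpolative_routeCW.rightFree_freeHull_flip, rightFree_union]
    exact Set.inter_subset_right
  le_inf C D D' h h' := by
    have hr := F.isInterpolative_routeCW
    rw [hr.leftFree_subset_iff_rightFree C.maximal (hr.maximal_freeHull_flip _),
      hr.rightFree_freeHull_flip, rightFree_union]
    exact Set.subset_inter ((hr.leftFree_subset_iff_rightFree C.maximal D.maximal).1 h)
      ((hr.leftFree_subset_iff_rightFree C.maximal D'.maximal).1 h')

/-- While `C` differs from `D`, `exists_rotation` moves it up without leaving the region below `D`.
Each move strictly shrinks `leftFree`, so finiteness of the set of routes ends the process. -/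
theorem leftFree_subset_iff_rotLE {C D : F.MaxClique} :
    leftFree F.RouteCW D.1 ⊆ leftFree F.RouteCW C.1 ↔ RotLE C D := by
  have hr := F.isInterpolative_routeCW
  constructor
  · intro h
    induction C using (InvImage.wf (fun C : F.MaxClique => leftFree F.RouteCW C.1)
      (wellFounded_lt (α := Set G.Route))).induction with
    | h C ih =>
      by_cases hCD : C = D
      · exact hCD ▸ Relation.ReflTransGen.refl
      · obtain ⟨D', hD', hne, ⟨R, hR, R', hRe, hRR'⟩, hle⟩ :=
          exists_rotation C.maximal D.maximal ((hr.leftFree_subset_iff D.maximal).1 h)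
            fun h' => hCD (Subtype.ext h')
        have hsub := leftFree_subset_of_rotation C.maximal hD' hR hRe hRR'
        obtain ⟨D₀, rfl⟩ : ∃ D₀ : F.MaxClique, D₀.1 = D' := ⟨⟨D', maximal_isClique_iff.2 hD'⟩, rfl⟩
        have hrot : CCWRotation C D₀ :=
          ⟨fun h' => hne (congrArg Subtype.val h'), R, hR, R', hRe, exists_cw_iff.2 hRR'⟩
        refine Relation.ReflTransGen.head hrot
          (ih D₀ (lt_of_le_of_ne hsub fun h' => ?_) ((hr.leftFree_subset_iff D.maximal).2 hle))
        exact hne (hr.eq_of_leftFree_eq C.maximal hD' h'.symm)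
  · intro h
    induction h with
    | refl => exact subset_rfl
    | tail _ h ih =>
      obtain ⟨-, R, hR, R', hRe, hRR'⟩ := h
      exact (leftFree_subset_of_rotation (MaxClique.maximal _) (MaxClique.maximal _) hR hRe
        (exists_cw_iff.1 hRR')).trans ih

end Finite

end Framing

end FlowGraph

/-- For every framed graph, the rotation order makes the maximal cliques a lattice in which the join
and the meet of `C` and `C'` are the results of the two greedy algorithms. -/
theorem mainTheorem6 {n : ℕ} {E : Type*} [Finite E] (G : FlowGraph n E) (F : G.Framing) :
    ∃ L : Lattice F.MaxClique,
      (∀ C D : F.MaxClique, L.le C D ↔ FlowGraph.Framing.RotLE C D) ∧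
      ∀ C C' : F.MaxClique,
        (L.sup C C').1 = F.CmaxRem C.1 C'.1 ∧ (L.inf C C').1 = F.CminRem C.1 C'.1 := by
  refine ⟨F.framingLattice, fun C D => FlowGraph.Framing.leftFree_subset_iff_rotLE,
    fun C C' => ⟨?_, ?_⟩⟩
  · exact (FlowGraph.Framing.CmaxRem_eq_freeHull C.maximal.prop C'.maximal.prop).symm
  · exact (FlowGraph.Framing.CminRem_eq_freeHull C.maximal.prop C'.maximal.prop).symm
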